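/- **Systems.** Finite types are generated from $0$ by $\sigma\to\tau$ and $\sigma^*$ (finite sequences); $1=0\to0$, $2=1\to0$. $\mathsf{RCA}_0^\omega$ is the classical theory of Kohlenbach in all finite types (formulated with sequence types): only equality $=_0$ of type $0$ is primitive and equality at other types is defined extensionally; the axioms are those for successor, the combinators $\Pi,\Sigma$, the recursor $R_0$ of type $0$, finite sequences (length, projection, formation of initial segments), extensionality $x=_\rho y\to\varphi(x)=_\tau\varphi(y)$, quantifier-free induction, and $\mathsf{QF\text{-}AC}^{1,0}$. $\mathsf{RCA}_0^\Lambda$ adds a predicate $\mathrm{st}$ on every type, with the axiom schemas: $\mathrm{st}(x)\wedge x=y\to\mathrm{st}(y)$; $\mathrm{st}(t)$ for closed terms $t$; $\mathrm{st}(f)\wedge\mathrm{st}(x)\to\mathrm{st}(f(x))$; and, for every formula $\varphi$ without $\mathrm{st}$ (parameters allowed), $$(\forall^{\mathrm{st}}x^\rho)(\exists^{\mathrm{st}}y^\tau)\varphi(x,y)\to(\exists^{\mathrm{st}}F^{\rho\to\tau^*})(\forall^{\mathrm{st}}x^\rho)(\exists y\in F(x))\varphi(x,y),$$ $$(\forall^{\mathrm{st}}w^{\sigma^*})(\exists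 y^\tau)(\forall x\in w)\varphi(x,y)\to(\exists y^\tau)(\forall^{\mathrm{st}}x^\sigma)\varphi(x,y).$$ Here $\forall^{\mathrm{st}},\exists^{\mathrm{st}}$ are the quantifiers restricted to $\mathrm{st}$. **Notions.** Finite sequences of numbers are coded by numbers; $\overline{f}n$ is the code of $\langle f(0),\dots,f(n-1)\rangle$. A binary tree is a $\{0,1\}$-valued $T^1$ such that the $\sigma$ with $T(\sigma)=1$ (written $\sigma\in T$) are codes of finite $0$-$1$-sequences and are closed under initial segments. $\nu(T)>0$ means $(\exists k>0)(\forall n)\big(|\{\sigma\in T:|\sigma|=n\}|\ge 2^n/k\big)$. $\mathsf{UWWKL}(\alpha,T)$ is the formula: if $T$ is a binary tree and $\nu(T)>0$, then $(\forall m)(\overline{\alpha}m\in T)$. For $\Phi^{1\to1}$, $\mathsf{UWWKL}(\Phi)$ is $(\forall T^1)\,\mathsf{UWWKL}(\Phi(T),T)$. For type-$1$ objects, $f\approx_1g$ is $(\forall^{\mathrm{st}}n^0)(f(n)=g(n))$. Put $$\mathsf{UWWKL}^+:\quad(\exists^{\mathrm{st}}\Phi^{1\to1})\big[(\forall^{\mathrm{st}}T^1)\,\mathsf{UWWKL}(\Phi(T),T)\wedge(\forall^{\mathrm{st}}T^1,S^1)(T\approx_1S\to\Phi(T)\approx_1\Phi(S))\big],$$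 $$\Pi^0_1\text{-}\mathsf{TRANS}:\quad(\forall^{\mathrm{st}}f^1)\big[(\forall^{\mathrm{st}}n)f(n)\ne0\to(\forall n)f(n)\ne0\big],$$ $$\mathsf{MU}(\mu^2):\quad(\forall f^1)\big[(\exists x)f(x)=0\to f(\mu(f))=0\big].$$ $\Xi$ (of type $1\to1\to0\to0$) is an extensionality functional for $\Phi^{1\to1}$ if $(\forall k^0,f^1,g^1)\big[\overline{f}\,\Xi(f,g,k)=\overline{g}\,\Xi(f,g,k)\to\overline{\Phi(f)}k=\overline{\Phi(g)}k\big]$. **Theorem.** (1) $\mathsf{RCA}_0^\Lambda$ proves $\mathsf{UWWKL}^+\leftrightarrow\Pi^0_1\text{-}\mathsf{TRANS}$. (2) There are closed terms $s,t$ of the language of $\mathsf{RCA}_0^\omega$ such that $\mathsf{RCA}_0^\omega$ proves $$(\forall\mu^2)\big[\mathsf{MU}(\mu)\to\mathsf{UWWKL}(s(\mu))\big]\wedge(\forall\Phi,\Xi)\big[\mathsf{UWWKL}(\Phi)\wedge\Xi\text{ is an extensionality functional for }\Phi\to\mathsf{MU}(t(\Phi,\Xi))\big].$$ -/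

import Mathlib

/-! # Arithmetic in all finite types, with and without a standardness predicate

The file formalizes the classical, many-sorted deductive systems `RCA₀^ω` (Kohlenbach's base theory
of higher-order reverse mathematics, in the language with finite-sequence types) and its
nonstandard extension `RCA₀^Λ`, and the sentences of those languages that the theorem is about. -/

namespace FT

/-- Finite types: `0`, function types `σ → τ`, and types `σ*` of finite sequences. -/
inductive Ty : Type
  | nat : Ty
  | arr : Ty → Ty → Ty
  | seq : Ty → Ty

infixr:60 "⇒" => FT.Ty.arr

/-- The type `1 = 0 → 0`. -/
abbrev one : Ty := Ty.nat ⇒ Ty.nat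

/-- The type `2 = 1 → 0`. -/
abbrev two : Ty := one ⇒ Ty.nat

/-- Contexts: the lists of the types of the free variables (de Bruijn style, innermost first). -/
abbrev Ctx : Type := List Ty

/-- Variables of type `σ` in a context. -/
inductive Var : Ctx → Ty → Type
  | z {Γ : Ctx} {σ : Ty} : Var (σ :: Γ) σ
  | s {Γ : Ctx} {σ τ : Ty} : Var Γ σ → Var (τ :: Γ) σ

/-- The constants: zero, successor, the combinators `Π` and `Σ`, the recursor `R₀` (recursion of
type `0` only), and for finite sequences the length `|s|`, the projection `(s, i) ↦ s_i`, and
`(f, n) ↦ ⟨f 0, …, f (n - 1)⟩`. -/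
inductive Cst : Ty → Type
  | zero : Cst Ty.nat
  | succ : Cst (Ty.nat ⇒ Ty.nat)
  | K (σ τ : Ty) : Cst (σ ⇒ τ ⇒ σ)
  | S (ρ σ τ : Ty) : Cst ((ρ ⇒ σ ⇒ τ) ⇒ (ρ ⇒ σ) ⇒ ρ ⇒ τ)
  | R : Cst (Ty.nat ⇒ Ty.nat ⇒ (Ty.nat ⇒ Ty.nat ⇒ Ty.nat) ⇒ Ty.nat)
  | len (σ : Ty) : Cst (Ty.seq σ ⇒ Ty.nat)
  | get (σ : Ty) : Cst (Ty.seq σ ⇒ Ty.nat ⇒ σ)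
  | mk (σ : Ty) : Cst ((Ty.nat ⇒ σ) ⇒ Ty.nat ⇒ Ty.seq σ)

/-- Terms of type `σ` over a context. -/
inductive Tm (Γ : Ctx) : Ty → Type
  | var {σ : Ty} : Var Γ σ → Tm Γ σ
  | cst {σ : Ty} : Cst σ → Tm Γ σ
  | app {σ τ : Ty} : Tm Γ (σ ⇒ τ) → Tm Γ σ → Tm Γ τ

infixl:70 "⬝" => FT.Tm.app

/-- Renamings and substitutions of variables. -/
abbrev Ren (Γ Δ : Ctx) : Type := ∀ σ : Ty, Var Γ σ → Var Δ σ

abbrev Sub (Γ Δ : Ctx) : Type := ∀ σ : Ty, Var Γ σ → Tm Δ σ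

/-- The renaming that passes under a binder. -/
def Ren.lift {Γ Δ : Ctx} (r : Ren Γ Δ) (ρ : Ty) : Ren (ρ :: Γ) (ρ :: Δ)
  | _, .z => .z
  | _, .s v => .s (r _ v)

def Ren.shift {Γ : Ctx} (ρ : Ty) : Ren Γ (ρ :: Γ) := fun _ v => .s v

namespace Tm

def subst {Γ Δ : Ctx} (f : Sub Γ Δ) : {σ : Ty} → Tm Γ σ → Tm Δ σ
  | _, .var v => f _ v
  | _, .cst c => .cst c
  | _, .app a b => .app (a.subst f) (b.subst f)

def rename {Γ Δ : Ctx} (r : Ren Γ Δ) {σ : Ty} (t : Tm Γ σ) : Tm Δ σ :=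
  t.subst fun _ v => .var (r _ v)

/-- Weakening by one variable. -/
def wk {Γ : Ctx} {ρ σ : Ty} (t : Tm Γ σ) : Tm (ρ :: Γ) σ := t.rename (Ren.shift ρ)

/-- A closed term, seen in an arbitrary context. -/
def ofClosed {Γ : Ctx} {σ : Ty} (t : Tm [] σ) : Tm Γ σ := t.rename fun _ v => by cases v

/-- The innermost variable is sent to `none`, the other variables to themselves. -/
def dropVar {Γ : Ctx} {σ : Ty} : {τ : Ty} → Var (σ :: Γ) τ → Option (Tm Γ τ)
  | _, .z => none
  | _, .s v => some (.var v)

/-- The term with the innermost variable removed from its context, if that does not occur. -/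
def drop {Γ : Ctx} {σ : Ty} : {τ : Ty} → Tm (σ :: Γ) τ → Option (Tm Γ τ)
  | _, .var v => dropVar v
  | _, .cst c => some (.cst c)
  | _, .app a b => a.drop.bind fun a' => b.drop.map fun b' => a' ⬝ b'

def lamVar {Γ : Ctx} {σ : Ty} : {τ : Ty} → Var (σ :: Γ) τ → Tm Γ (σ ⇒ τ)
  | _, .z => .cst (.S σ (σ ⇒ σ) σ) ⬝ .cst (.K σ (σ ⇒ σ)) ⬝ .cst (.K σ σ)
  | _, .s v => .cst (.K _ σ) ⬝ .var v

/-- `λ`-abstraction of the innermost variable, defined from the combinators: `λx.x = Σ Π Π`,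
`λx.t = Π t` if `x` does not occur in `t`, and `λx.a b = Σ (λx.a) (λx.b)` otherwise. -/
def lam {Γ : Ctx} {σ : Ty} : {τ : Ty} → Tm (σ :: Γ) τ → Tm Γ (σ ⇒ τ)
  | _, .var v => lamVar v
  | _, .cst c => .cst (.K _ σ) ⬝ .cst c
  | _, .app a b =>
    (Tm.drop (a ⬝ b)).elim (.cst (.S σ _ _) ⬝ a.lam ⬝ b.lam) fun t => .cst (.K _ σ) ⬝ t

variable {Γ : Ctx} {ρ σ τ υ : Ty}

/-- The variables number 0, 1, 2, 3 of the context. -/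
abbrev v0 : Tm (σ :: Γ) σ := .var .z

abbrev v1 : Tm (ρ :: σ :: Γ) σ := .var (.s .z)

abbrev v2 : Tm (τ :: ρ :: σ :: Γ) σ := .var (.s (.s .z))

abbrev v3 : Tm (υ :: τ :: ρ :: σ :: Γ) σ := .var (.s (.s (.s .z)))

abbrev zero : Tm Γ Ty.nat := .cst .zero

abbrev suc (t : Tm Γ Ty.nat) : Tm Γ Ty.nat := .cst .succ ⬝ t

/-- Primitive recursion: `rc 0 y z = y` and `rc (x + 1) y z = z (rc x y z) x`. -/
abbrev rc (x y : Tm Γ Ty.nat) (z : Tm Γ (Ty.nat ⇒ Ty.nat ⇒ Ty.nat)) : Tm Γ Ty.nat :=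
  .cst .R ⬝ x ⬝ y ⬝ z

abbrev len (s : Tm Γ (Ty.seq σ)) : Tm Γ Ty.nat := .cst (.len σ) ⬝ s

abbrev get (s : Tm Γ (Ty.seq σ)) (i : Tm Γ Ty.nat) : Tm Γ σ := .cst (.get σ) ⬝ s ⬝ i

abbrev mk (f : Tm Γ (Ty.nat ⇒ σ)) (n : Tm Γ Ty.nat) : Tm Γ (Ty.seq σ) := .cst (.mk σ) ⬝ f ⬝ n

/-- The zero object of each type. -/
def zeroOf {Γ : Ctx} : (σ : Ty) → Tm Γ σ
  | .nat => zero
  | .arr σ τ => .cst (.K τ σ) ⬝ zeroOf τ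
  | .seq σ => mk (.cst (.K σ .nat) ⬝ zeroOf σ) zero

/-! Primitive recursive functions, as closed terms. -/

/-- `x + y` -/
def add : Tm Γ (Ty.nat ⇒ Ty.nat ⇒ Ty.nat) :=
  lam (lam (rc v0 v1 (lam (lam (suc v1)))))

/-- `x * y` -/
def mul : Tm Γ (Ty.nat ⇒ Ty.nat ⇒ Ty.nat) :=
  lam (lam (rc v0 zero (lam (lam (add ⬝ v1 ⬝ v3)))))

/-- The predecessor, with value `0` at `0`. -/
def pred : Tm Γ one := lam (rc v0 zero (lam (lam v0)))

/-- Truncated subtraction. -/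
def monus : Tm Γ (Ty.nat ⇒ Ty.nat ⇒ Ty.nat) :=
  lam (lam (rc v0 v1 (lam (lam (pred ⬝ v1)))))

/-- `2 ^ n` -/
def pow2 : Tm Γ one := lam (rc v0 (suc zero) (lam (lam (add ⬝ v1 ⬝ v1))))

/-- The remainder of `n` modulo 2. -/
def parity : Tm Γ one := lam (rc v0 zero (lam (lam (monus ⬝ suc zero ⬝ v1))))

/-- The integer part of `n / 2`. -/
def half : Tm Γ one := lam (rc v0 zero (lam (lam (add ⬝ v1 ⬝ (parity ⬝ v0)))))

/-- `dig i k` is the binary digit number `k` of `i`, that of weight `2 ^ k`. -/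
def dig : Tm Γ (Ty.nat ⇒ one) :=
  lam (lam (parity ⬝ rc v0 v1 (lam (lam (half ⬝ v1)))))

/-- The triangular number `0 + 1 + ⋯ + n`. -/
def tri : Tm Γ one := lam (rc v0 zero (lam (lam (add ⬝ v1 ⬝ suc v0))))

/-- Cantor's pairing function. -/
def pair : Tm Γ (Ty.nat ⇒ Ty.nat ⇒ Ty.nat) :=
  lam (lam (add ⬝ (tri ⬝ (add ⬝ v1 ⬝ v0)) ⬝ v0))

/-- `bar f n` is the code of the initial segment `⟨f 0, …, f (n - 1)⟩`. The coding is a bijection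
between finite sequences of numbers and numbers: the empty sequence has code `0`, and the extension
of a sequence with code `c` by the entry `a` has code `pair c a + 1`. -/
def bar : Tm Γ (one ⇒ Ty.nat ⇒ Ty.nat) :=
  lam (lam (rc v0 zero (lam (lam (suc (pair ⬝ v1 ⬝ (v3 ⬝ v0)))))))

/-- `count T n` is the number of binary sequences of length `n` in the set with characteristic
function `T`; these sequences are listed as the digit sequences of the numbers `i < 2 ^ n`. -/
def count : Tm Γ (one ⇒ Ty.nat ⇒ Ty.nat) :=
  lam (lam (rc (pow2 ⬝ v0) zero (lam (lam (add ⬝ v1 ⬝ (v3 ⬝ (bar ⬝ (dig ⬝ v0) ⬝ v2)))))))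

end Tm

/-- Formulas over a context. The flag says whether the language contains the standardness predicate
`st` (one for each type); equality of type `0` is the only other primitive predicate. The logic is
classical, and the connectives other than falsum, implication and `∀` are defined. -/
inductive Fm (b : Bool) : Ctx → Type
  | eq {Γ : Ctx} : Tm Γ Ty.nat → Tm Γ Ty.nat → Fm b Γ
  | st {Γ : Ctx} (h : b = true) {σ : Ty} : Tm Γ σ → Fm b Γ
  | bot {Γ : Ctx} : Fm b Γ
  | imp {Γ : Ctx} : Fm b Γ → Fm b Γ → Fm b Γ
  | all {Γ : Ctx} (σ : Ty) : Fm b (σ :: Γ) → Fm b Γ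

/-- The substitution that passes under a binder. -/
def Sub.lift {Γ Δ : Ctx} (f : Sub Γ Δ) (ρ : Ty) : Sub (ρ :: Γ) (ρ :: Δ)
  | _, .z => .var .z
  | _, .s v => (f _ v).wk

/-- The substitution that replaces the innermost variable by a term. -/
def Sub.one {Γ : Ctx} {ρ : Ty} (t : Tm Γ ρ) : Sub (ρ :: Γ) Γ
  | _, .z => t
  | _, .s v => .var v

namespace Fm

def subst {b : Bool} : {Γ Δ : Ctx} → Sub Γ Δ → Fm b Γ → Fm b Δ
  | _, _, f, .eq s t => .eq (s.subst f) (t.subst f)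
  | _, _, f, .st h t => .st h (t.subst f)
  | _, _, _, .bot => .bot
  | _, _, f, .imp A B => .imp (A.subst f) (B.subst f)
  | _, _, f, .all σ A => .all σ (A.subst (f.lift σ))

def rename {b : Bool} {Γ Δ : Ctx} (r : Ren Γ Δ) (A : Fm b Γ) : Fm b Δ :=
  A.subst fun _ v => .var (r _ v)

/-- Weakening by one variable. -/
def wk {b : Bool} {Γ : Ctx} {ρ : Ty} (A : Fm b Γ) : Fm b (ρ :: Γ) := A.rename (Ren.shift ρ)

/-- `A.inst t` is `A` with the innermost variable replaced by `t`. -/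
def inst {b : Bool} {Γ : Ctx} {ρ : Ty} (A : Fm b (ρ :: Γ)) (t : Tm Γ ρ) : Fm b Γ :=
  A.subst (Sub.one t)

variable {b : Bool} {Γ : Ctx}

abbrev neg (A : Fm b Γ) : Fm b Γ := .imp A .bot

abbrev and (A B : Fm b Γ) : Fm b Γ := neg (.imp A (neg B))

abbrev iff (A B : Fm b Γ) : Fm b Γ := and (.imp A B) (.imp B A)

abbrev ex (σ : Ty) (A : Fm b (σ :: Γ)) : Fm b Γ := neg (.all σ (neg A))

/-- `t` is standard. -/
abbrev std {σ : Ty} (t : Tm Γ σ) : Fm true Γ := .st rfl t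

/-- Quantification over the standard objects of a type. -/
abbrev allst (σ : Ty) (A : Fm true (σ :: Γ)) : Fm true Γ := .all σ (.imp (std .v0) A)

abbrev exst (σ : Ty) (A : Fm true (σ :: Γ)) : Fm true Γ := .ex σ (.and (std .v0) A)

/-- `s ≤ t` for numbers. -/
abbrev le (s t : Tm Γ Ty.nat) : Fm b Γ := .eq (Tm.monus ⬝ s ⬝ t) .zero

/-- `s < t` for numbers. -/
abbrev lt (s t : Tm Γ Ty.nat) : Fm b Γ := le (.suc s) t

/-- Extensional equality at an arbitrary type, defined from equality of type `0`. -/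
def eqOf {b : Bool} : {Γ : Ctx} → (σ : Ty) → Tm Γ σ → Tm Γ σ → Fm b Γ
  | _, .nat, s, t => .eq s t
  | _, .arr σ τ, s, t => .all σ (eqOf τ (s.wk ⬝ .v0) (t.wk ⬝ .v0))
  | _, .seq σ, s, t =>
    .and (.eq s.len t.len)
      (.all .nat (.imp (.lt .v0 s.wk.len) (eqOf σ (s.wk.get .v0) (t.wk.get .v0))))

/-- `t` is an entry of the finite sequence `s`. -/
def mem {σ : Ty} (t : Tm Γ σ) (s : Tm Γ (Ty.seq σ)) : Fm b Γ :=
  .ex .nat (.and (.lt .v0 s.wk.len) (eqOf σ t.wk (s.wk.get .v0)))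

/-- Quantifier-free formulas (without `st`). -/
inductive IsQF {b : Bool} {Γ : Ctx} : Fm b Γ → Prop
  | eq (s t : Tm Γ Ty.nat) : IsQF (.eq s t)
  | bot : IsQF .bot
  | imp {A B : Fm b Γ} : IsQF A → IsQF B → IsQF (.imp A B)

/-- Internal formulas: those in which `st` does not occur. -/
inductive IsInternal {b : Bool} : {Γ : Ctx} → Fm b Γ → Prop
  | eq {Γ : Ctx} (s t : Tm Γ Ty.nat) : IsInternal (.eq s t)
  | bot {Γ : Ctx} : IsInternal (.bot : Fm b Γ)
  | imp {Γ : Ctx} {A B : Fm b Γ} : IsInternal A → IsInternal B → IsInternal (.imp A B)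
  | all {Γ : Ctx} {σ : Ty} {A : Fm b (σ :: Γ)} : IsInternal A → IsInternal (.all σ A)

end Fm

/-- Natural deduction for classical many-sorted predicate logic, from a set of axioms:
`Prf Ax Γ H A` says that `A` is derivable from the open assumptions `H`. -/
inductive Prf {b : Bool} (Ax : (Γ : Ctx) → Fm b Γ → Prop) :
    (Γ : Ctx) → List (Fm b Γ) → Fm b Γ → Prop
  | ax {Γ : Ctx} {H : List (Fm b Γ)} {A : Fm b Γ} : Ax Γ A → Prf Ax Γ H A
  | hyp {Γ : Ctx} {H : List (Fm b Γ)} {A : Fm b Γ} : A ∈ H → Prf Ax Γ H A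
  | impI {Γ : Ctx} {H : List (Fm b Γ)} {A B : Fm b Γ} :
      Prf Ax Γ (A :: H) B → Prf Ax Γ H (.imp A B)
  | impE {Γ : Ctx} {H : List (Fm b Γ)} {A B : Fm b Γ} :
      Prf Ax Γ H (.imp A B) → Prf Ax Γ H A → Prf Ax Γ H B
  | raa {Γ : Ctx} {H : List (Fm b Γ)} {A : Fm b Γ} :
      Prf Ax Γ (A.neg :: H) .bot → Prf Ax Γ H A
  | allI {Γ : Ctx} {H : List (Fm b Γ)} {σ : Ty} {A : Fm b (σ :: Γ)} :
      Prf Ax (σ :: Γ) (H.map Fm.wk) A → Prf Ax Γ H (.all σ A)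
  | allE {Γ : Ctx} {H : List (Fm b Γ)} {σ : Ty} {A : Fm b (σ :: Γ)} (t : Tm Γ σ) :
      Prf Ax Γ H (.all σ A) → Prf Ax Γ H (A.inst t)

/-- A sentence is provable from the axioms. -/
def Provable {b : Bool} (Ax : (Γ : Ctx) → Fm b Γ → Prop) (A : Fm b []) : Prop := Prf Ax [] [] A

open Tm Fm in
/-- The axioms of `RCA₀^ω`: arithmetic in all finite types with extensionality, recursion of type
`0` and quantifier-free induction, the definitional extension by finite sequences, and the axiom of
choice `QF-AC^{1,0}`. Schemas may contain parameters of any type. -/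
inductive RCAomega (b : Bool) : (Γ : Ctx) → Fm b Γ → Prop
  | eq_refl {Γ : Ctx} (x : Tm Γ Ty.nat) : RCAomega b Γ (.eq x x)
  | eq_symm {Γ : Ctx} (x y : Tm Γ Ty.nat) : RCAomega b Γ (.imp (.eq x y) (.eq y x))
  | eq_trans {Γ : Ctx} (x y z : Tm Γ Ty.nat) :
      RCAomega b Γ (.imp (.eq x y) (.imp (.eq y z) (.eq x z)))
  | ext {Γ : Ctx} {ρ τ : Ty} (x y : Tm Γ ρ) (f : Tm Γ (ρ ⇒ τ)) :
      RCAomega b Γ (.imp (eqOf ρ x y) (eqOf τ (f ⬝ x) (f ⬝ y)))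
  | succ_ne_zero {Γ : Ctx} (x : Tm Γ Ty.nat) : RCAomega b Γ (.neg (.eq (suc x) zero))
  | succ_inj {Γ : Ctx} (x y : Tm Γ Ty.nat) :
      RCAomega b Γ (.imp (.eq (suc x) (suc y)) (.eq x y))
  | comb_K {Γ : Ctx} {σ τ : Ty} (x : Tm Γ σ) (y : Tm Γ τ) :
      RCAomega b Γ (eqOf σ (.cst (.K σ τ) ⬝ x ⬝ y) x)
  | comb_S {Γ : Ctx} {ρ σ τ : Ty} (x : Tm Γ (ρ ⇒ σ ⇒ τ)) (y : Tm Γ (ρ ⇒ σ)) (z : Tm Γ ρ) :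
      RCAomega b Γ (eqOf τ (.cst (.S ρ σ τ) ⬝ x ⬝ y ⬝ z) (x ⬝ z ⬝ (y ⬝ z)))
  | rec_zero {Γ : Ctx} (y : Tm Γ Ty.nat) (z : Tm Γ (Ty.nat ⇒ Ty.nat ⇒ Ty.nat)) :
      RCAomega b Γ (.eq (rc zero y z) y)
  | rec_succ {Γ : Ctx} (x y : Tm Γ Ty.nat) (z : Tm Γ (Ty.nat ⇒ Ty.nat ⇒ Ty.nat)) :
      RCAomega b Γ (.eq (rc (suc x) y z) (z ⬝ rc x y z ⬝ x))
  | len_mk {Γ : Ctx} {σ : Ty} (f : Tm Γ (Ty.nat ⇒ σ)) (n : Tm Γ Ty.nat) :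
      RCAomega b Γ (.eq (Tm.mk f n).len n)
  | get_mk {Γ : Ctx} {σ : Ty} (f : Tm Γ (Ty.nat ⇒ σ)) (n i : Tm Γ Ty.nat) :
      RCAomega b Γ (.imp (.lt i n) (eqOf σ ((Tm.mk f n).get i) (f ⬝ i)))
  | get_out {Γ : Ctx} {σ : Ty} (s : Tm Γ (Ty.seq σ)) (i : Tm Γ Ty.nat) :
      RCAomega b Γ (.imp (.neg (.lt i s.len)) (eqOf σ (s.get i) (zeroOf σ)))
  | qf_ind {Γ : Ctx} (A : Fm b (Ty.nat :: Γ)) : A.IsQF →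
      RCAomega b Γ (.imp (A.inst zero)
        (.imp (.all .nat (.imp A ((A.rename ((Ren.shift .nat).lift .nat)).inst (suc v0))))
          (.all .nat A)))
  | qf_ac {Γ : Ctx} (A : Fm b (Ty.nat :: one :: Γ)) : A.IsQF →
      RCAomega b Γ (.imp (.all one (.ex .nat A))
        (.ex two (.all one
          ((A.rename (((Ren.shift two).lift one).lift .nat)).inst (v1 ⬝ v0)))))

open Tm Fm in
/-- The axioms of `RCA₀^Λ`: those of `RCA₀^ω`, the three basic schemas on `st`, the Herbrandized
axiom of choice
`(∀ˢᵗ x)(∃ˢᵗ y) A(x, y) → (∃ˢᵗ F)(∀ˢᵗ x)(∃ y ∈ F(x)) A(x, y)`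
and idealization
`(∀ˢᵗ w)(∃ y)(∀ x ∈ w) A(x, y) → (∃ y)(∀ˢᵗ x) A(x, y)`
for internal `A` with parameters. -/
inductive RCALambda : (Γ : Ctx) → Fm true Γ → Prop
  | omega {Γ : Ctx} {A : Fm true Γ} : RCAomega true Γ A → RCALambda Γ A
  | st_eq {Γ : Ctx} {σ : Ty} (x y : Tm Γ σ) :
      RCALambda Γ (.imp (std x) (.imp (eqOf σ x y) (std y)))
  | st_closed {Γ : Ctx} {σ : Ty} (t : Tm [] σ) : RCALambda Γ (std (ofClosed t))
  | st_app {Γ : Ctx} {σ τ : Ty} (f : Tm Γ (σ ⇒ τ)) (x : Tm Γ σ) :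
      RCALambda Γ (.imp (std f) (.imp (std x) (std (f ⬝ x))))
  | hac_int {Γ : Ctx} {ρ τ : Ty} (A : Fm true (τ :: ρ :: Γ)) : A.IsInternal →
      RCALambda Γ (.imp (allst ρ (exst τ A))
        (exst (ρ ⇒ Ty.seq τ) (allst ρ (.ex τ (.and (mem v0 (v2 ⬝ v1))
          (A.rename (((Ren.shift (ρ ⇒ Ty.seq τ)).lift ρ).lift τ)))))))
  | ideal {Γ : Ctx} {σ τ : Ty} (A : Fm true (σ :: τ :: Γ)) : A.IsInternal →
      RCALambda Γ (.imp
        (allst (Ty.seq σ) (.ex τ (.all σ (.imp (mem v0 v2)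
          (A.rename (((Ren.shift (Ty.seq σ)).lift τ).lift σ))))))
        (.ex τ (allst σ A)))

/-! ### The sentences of the theorem -/

section Sentences

open Tm Fm

variable {b : Bool} {Γ : Ctx}

/-- `T` is (the characteristic function of) a binary tree: a set of codes of finite sequences of
zeros and ones that is closed under initial segments. -/
def binTree (T : Tm Γ one) : Fm b Γ :=
  .and (.all .nat (.le (T.wk ⬝ v0) (suc zero)))
    (.and
      (.all .nat (.imp (.eq (T.wk ⬝ v0) (suc zero))
        (.ex one (.ex .nat (.and (.all .nat (.le (v2 ⬝ v0) (suc zero)))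
          (.eq v2 (bar ⬝ v1 ⬝ v0)))))))
      (.all one (.all .nat (.all .nat (.imp (.le v0 v1)
        (.imp (.eq (T.wk.wk.wk ⬝ (bar ⬝ v2 ⬝ v1)) (suc zero))
          (.eq (T.wk.wk.wk ⬝ (bar ⬝ v2 ⬝ v0)) (suc zero))))))))

/-- `ν(T) > 0`: for some `k`, at least `2 ^ n / k` sequences of length `n` are in `T`, for all `n`.
(The inequality `2 ^ n ≤ k * count T n` excludes `k = 0`.) -/
def posMeasure (T : Tm Γ one) : Fm b Γ :=
  .ex .nat (.all .nat (.le (pow2 ⬝ v0) (mul ⬝ v1 ⬝ (count ⬝ T.wk.wk ⬝ v0))))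

/-- If `T` is a binary tree with `ν(T) > 0`, then `α` is a path through `T`. -/
def uwwklAt (α T : Tm Γ one) : Fm b Γ :=
  .imp (binTree T) (.imp (posMeasure T)
    (.all .nat (.eq (T.wk ⬝ (bar ⬝ α.wk ⬝ v0)) (suc zero))))

/-- `Φ` maps every binary tree of positive measure to a path through it. -/
def uwwkl (Φ : Tm Γ (one ⇒ one)) : Fm b Γ := .all one (uwwklAt (Φ.wk ⬝ v0) v0)

/-- `Ξ` is an extensionality functional for `Φ`: equality of `f` and `g` up to `Ξ(f, g, k)`
guarantees equality of `Φ(f)` and `Φ(g)` up to `k`. -/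
def extFunctional (Ξ : Tm Γ (one ⇒ one ⇒ Ty.nat ⇒ Ty.nat)) (Φ : Tm Γ (one ⇒ one)) : Fm b Γ :=
  .all .nat (.all one (.all one (.imp
    (.eq (bar ⬝ v1 ⬝ (Ξ.wk.wk.wk ⬝ v1 ⬝ v0 ⬝ v2)) (bar ⬝ v0 ⬝ (Ξ.wk.wk.wk ⬝ v1 ⬝ v0 ⬝ v2)))
    (.eq (bar ⬝ (Φ.wk.wk.wk ⬝ v1) ⬝ v2) (bar ⬝ (Φ.wk.wk.wk ⬝ v0) ⬝ v2)))))

/-- `μ` is Feferman's non-constructive search operator. -/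
def isMu (μ : Tm Γ two) : Fm b Γ :=
  .all one (.imp (.ex .nat (.eq (v1 ⬝ v0) zero)) (.eq (v0 ⬝ (μ.wk ⬝ v0)) zero))

/-- `f ≈ g`: the values at all standard numbers are equal. -/
def approx (f g : Tm Γ one) : Fm true Γ := allst .nat (.eq (f.wk ⬝ v0) (g.wk ⬝ v0))

/-- `UWWKL⁺`: some standard, standard-extensional functional maps every standard binary tree of
positive measure to a path through it. -/
def uwwklPlus : Fm true [] :=
  exst (one ⇒ one) (.and
    (allst one (uwwklAt (v1 ⬝ v0) v0))
    (allst one (allst one (.imp (approx v1 v0) (approx (v2 ⬝ v1) (v2 ⬝ v0))))))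

/-- `Π⁰₁-TRANS`: if a standard `f` has no standard zero, then it has no zero. -/
def piTrans : Fm true [] :=
  allst one (.imp (allst .nat (.neg (.eq (v1 ⬝ v0) zero))) (.all .nat (.neg (.eq (v1 ⬝ v0) zero))))

/-- Every `μ` as in `(μ²)` computes, through the closed term `s`, a uniform `WWKL` functional. -/
def muToUwwkl (s : Tm [] (two ⇒ one ⇒ one)) : Fm false [] :=
  .all two (.imp (isMu v0) (uwwkl (ofClosed s ⬝ v0)))

/-- Every uniform `WWKL` functional `Φ` together with an extensionality functional `Ξ` for it
computes, through the closed term `t`, a functional as in `(μ²)`. -/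
def uwwklToMu (t : Tm [] ((one ⇒ one) ⇒ (one ⇒ one ⇒ Ty.nat ⇒ Ty.nat) ⇒ two)) : Fm false [] :=
  .all (one ⇒ one) (.all (one ⇒ one ⇒ Ty.nat ⇒ Ty.nat)
    (.imp (uwwkl v1) (.imp (extFunctional v0 v1) (isMu (ofClosed t ⬝ v1 ⬝ v0)))))

end Sentences

end FT

/-! # Uniform weak weak König's lemma and transfer

Provability is reduced to truth. By Henkin's construction (`exists_termStr`), an unprovable
sentence fails in a term model of the axioms, and since equality at higher types is defined
extensionally and all functions respect it, the quotient of this structure by extensional equality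
is a model in which equality is real (`exists_model`). So both parts can be shown by arguing in an
arbitrary `Model`. The numbers of a model form a discretely ordered semiring, in which functions
given by terms may be used, and in which induction holds for predicates with characteristic
functions (`Model.induction`).

*From uniform paths to zeros.* For a function `f` and `c ≤ 1`, let `tree f c` consist of those
binary sequences that start with `c` or are not longer than the first zero of `f`. It has measure
at least `1 / 2`. If `f` has no zeros, then it is the full tree, and otherwise its paths start with
`c`. For `c = 1 - Φ(full)(0)`, a zero of `f` makes the paths that `Φ` selects in the full tree and
in `tree f c` differ at `0` (`Model.path_ne`). The two trees agree below every number below which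
`f` has no zeros (`Model.full_eq_tree`). Hence an extensionality functional for `Φ` yields a bound
on a zero of `f` (`Model.muTerm_spec`), and if `f` and `Φ` are standard, `f` has no standard zeros,
and `Φ` is standard extensional, then `f` has no zeros at all (`Model.trans_of_isStdUniform`).

*From zeros to uniform paths.* A search operator `μ` decides whether a sequence has extensions of
all lengths in a tree `T`, and so computes a path, step by step (`Model.isPath_path`). With
standard objects, Herbrandized choice and transfer provide a standard `μ` that is correct for
standard functions. The path through a standard tree `T` depends on the correctness of `μ` for a
sequence of functions, of which those with standard index are standard, and a second use of
transfer gives correctness for the whole sequence (`Model.exists_isStdUniform`). Standard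
extensionality holds because standard functions that agree on the standard numbers are equal, again
by transfer.
-/

namespace FT

/-! ### Substitution -/

namespace Tm

theorem subst_subst {Γ Δ Θ : Ctx} (f : Sub Γ Δ) (g : Sub Δ Θ) {σ : Ty} (t : Tm Γ σ) :
    (t.subst f).subst g = t.subst fun _ v => (f _ v).subst g := by
  induction t with
  | var v => rfl
  | cst c => rfl
  | app a b iha ihb => simp only [subst, iha, ihb]

theorem subst_var {Γ : Ctx} {σ : Ty} (t : Tm Γ σ) : t.subst (fun _ v => .var v) = t := by
  induction t with
  | var v => rfl
  | cst c => rfl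
  | app a b iha ihb => simp only [subst, iha, ihb]

theorem wk_subst_lift {Γ Δ : Ctx} (f : Sub Γ Δ) {ρ σ : Ty} (t : Tm Γ σ) :
    (t.wk (ρ := ρ)).subst (f.lift ρ) = (t.subst f).wk := by
  simp only [wk, rename, subst_subst]
  rfl

theorem wk_subst_one {Γ : Ctx} {ρ σ : Ty} (t : Tm Γ σ) (s : Tm Γ ρ) :
    t.wk.subst (Sub.one s) = t := by
  simp only [wk, rename, subst_subst]
  exact subst_var t

end Tm

theorem Sub.lift_comp {Γ Δ Θ : Ctx} (f : Sub Γ Δ) (g : Sub Δ Θ) (ρ : Ty) :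
    (fun σ v => (f.lift ρ σ v).subst (g.lift ρ)) = Sub.lift (fun σ v => (f σ v).subst g) ρ := by
  funext σ v
  cases v with
  | z => rfl
  | s v => exact Tm.wk_subst_lift g (f _ v)

theorem Sub.lift_var {Γ : Ctx} (ρ : Ty) :
    Sub.lift (fun _ v => .var v : Sub Γ Γ) ρ = fun _ v => .var v := by
  funext σ v
  cases v <;> rfl

namespace Fm

variable {b : Bool}

theorem subst_subst {Γ Δ Θ : Ctx} (f : Sub Γ Δ) (g : Sub Δ Θ) (A : Fm b Γ) :
    (A.subst f).subst g = A.subst fun _ v => (f _ v).subst g := by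
  induction A generalizing Δ Θ with
  | eq s t => simp only [subst, Tm.subst_subst]
  | st h t => simp only [subst, Tm.subst_subst]
  | bot => rfl
  | imp A B ihA ihB => simp only [subst, ihA, ihB]
  | all σ A ih => simp only [subst, ih, Sub.lift_comp]

theorem subst_var {Γ : Ctx} (A : Fm b Γ) : A.subst (fun _ v => .var v) = A := by
  induction A with
  | eq s t => simp only [subst, Tm.subst_var]
  | st h t => simp only [subst, Tm.subst_var]
  | bot => rfl
  | imp A B ihA ihB => simp only [subst, ihA, ihB]
  | all σ A ih => simp only [subst, Sub.lift_var, ih]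

theorem eqOf_subst {Γ Δ : Ctx} (f : Sub Γ Δ) (σ : Ty) (s t : Tm Γ σ) :
    (eqOf (b := b) σ s t).subst f = eqOf σ (s.subst f) (t.subst f) := by
  induction σ generalizing Γ Δ with
  | nat => rfl
  | arr σ τ _ ih => simp only [eqOf, subst, ih, Tm.subst, Tm.wk_subst_lift]; rfl
  | seq σ ih =>
    simp only [eqOf, subst, ih, Tm.subst, Tm.wk_subst_lift]; rfl

end Fm

/-! ### Countability of the language -/

/-- A code of a finite type. -/
def Ty.code : Ty → ℕ
  | .nat => 0
  | .arr σ τ => 2 * Nat.pair σ.code τ.code + 1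
  | .seq σ => 2 * σ.code + 2

theorem Ty.code_injective : Function.Injective Ty.code := by
  intro σ
  induction σ with
  | nat => intro τ h; cases τ <;> simp [Ty.code] at h ⊢
  | arr σ τ ih₁ ih₂ =>
    intro τ h
    cases τ <;> simp [Ty.code] at h ⊢
    · exact ⟨ih₁ h.1, ih₂ h.2⟩
    · omega
  | seq σ ih =>
    intro τ h
    cases τ <;> simp [Ty.code] at h ⊢
    · omega
    · exact ih h

instance : Countable Ty := Ty.code_injective.countable

/-- The de Bruijn index of a variable. -/
def Var.code : {Γ : Ctx} → {σ : Ty} → Var Γ σ → ℕ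
  | _, _, .z => 0
  | _, _, .s v => v.code + 1

theorem Var.code_injective {Γ : Ctx} {σ : Ty} : Function.Injective (Var.code (Γ := Γ) (σ := σ)) := by
  intro v
  induction v with
  | z => intro w h; cases w <;> simp [Var.code] at h ⊢
  | s v ih =>
    intro w h
    cases w <;> simp [Var.code] at h ⊢
    exact ih h

/-- The kind of a constant; constants of the same type and kind are equal. -/
def Cst.code : {σ : Ty} → Cst σ → ℕ
  | _, .zero => 0
  | _, .succ => 1
  | _, .K _ _ => 2
  | _, .S _ _ _ => 3
  | _, .R => 4
  | _, .len _ => 5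
  | _, .get _ => 6
  | _, .mk _ => 7

theorem Cst.code_injective {σ : Ty} : Function.Injective (Cst.code (σ := σ)) := by
  intro c d h
  cases c <;> cases d <;> rfl

/-- A code of a term. -/
def Tm.code {Γ : Ctx} : {σ : Ty} → Tm Γ σ → ℕ
  | _, .var v => 3 * v.code
  | _, .cst c => 3 * c.code + 1
  | _, .app (σ := σ) a b => 3 * Nat.pair σ.code (Nat.pair a.code b.code) + 2

theorem Tm.code_injective {Γ : Ctx} {σ : Ty} : Function.Injective (Tm.code (Γ := Γ) (σ := σ)) := by
  intro s
  induction s with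
  | var v =>
    intro t h
    cases t <;> simp only [Tm.code] at h <;> try omega
    rw [Var.code_injective (Nat.eq_of_mul_eq_mul_left (by norm_num) h)]
  | cst c =>
    intro t h
    cases t <;> simp only [Tm.code] at h <;> try omega
    rw [Cst.code_injective (Nat.eq_of_mul_eq_mul_left three_pos (Nat.add_right_cancel h))]
  | app a b iha ihb =>
    intro t h
    cases t <;> simp only [Tm.code] at h <;> try omega
    simp only [add_left_inj, mul_eq_mul_left_iff, Nat.pair_eq_pair, OfNat.ofNat_ne_zero,
      or_false] at h
    obtain ⟨h₁, h₂, h₃⟩ := h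
    obtain rfl := Ty.code_injective h₁
    rw [iha h₂, ihb h₃]

/-- A code of a formula. -/
def Fm.code {b : Bool} : {Γ : Ctx} → Fm b Γ → ℕ
  | _, .eq s t => 5 * Nat.pair s.code t.code
  | _, .st (σ := σ) _ t => 5 * Nat.pair σ.code t.code + 1
  | _, .bot => 2
  | _, .imp A B => 5 * Nat.pair A.code B.code + 3
  | _, .all σ A => 5 * Nat.pair σ.code A.code + 4

theorem Fm.code_injective {b : Bool} {Γ : Ctx} : Function.Injective (Fm.code (b := b) (Γ := Γ)) := by
  intro A
  induction A with
  | eq s t =>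
    intro B h
    cases B <;> simp only [Fm.code] at h <;> try omega
    simp only [mul_eq_mul_left_iff, Nat.pair_eq_pair, OfNat.ofNat_ne_zero,
      or_false] at h
    rw [Tm.code_injective h.1, Tm.code_injective h.2]
  | st hb t =>
    intro B h
    cases B <;> simp only [Fm.code] at h <;> try omega
    simp only [add_left_inj, mul_eq_mul_left_iff, Nat.pair_eq_pair, OfNat.ofNat_ne_zero,
      or_false] at h
    obtain ⟨h₁, h₂⟩ := h
    obtain rfl := Ty.code_injective h₁
    rw [Tm.code_injective h₂]
  | bot =>
    intro B h
    cases B <;> simp only [Fm.code] at h <;> first | rfl | omega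
  | imp A A' ih ih' =>
    intro B h
    cases B <;> simp only [Fm.code] at h <;> try omega
    simp only [add_left_inj, mul_eq_mul_left_iff, Nat.pair_eq_pair, OfNat.ofNat_ne_zero,
      or_false] at h
    rw [ih h.1, ih' h.2]
  | all σ A ih =>
    intro B h
    cases B <;> simp only [Fm.code] at h <;> try omega
    simp only [add_left_inj, mul_eq_mul_left_iff, Nat.pair_eq_pair, OfNat.ofNat_ne_zero,
      or_false] at h
    obtain ⟨h₁, h₂⟩ := h
    obtain rfl := Ty.code_injective h₁
    rw [ih h₂]

instance {b : Bool} {Γ : Ctx} : Countable (Fm b Γ) := Fm.code_injective.countable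

instance : Nonempty Ty := ⟨.nat⟩

instance {b : Bool} {Γ : Ctx} : Nonempty (Fm b Γ) := ⟨.bot⟩

/-! ### Structures -/

/-- A structure for the language: a carrier for each type, with interpretations of application, the
constants, equality of type `0` and standardness. -/
structure Str where
  C : Ty → Type
  app {σ τ : Ty} : C (σ ⇒ τ) → C σ → C τ
  cst {σ : Ty} : Cst σ → C σ
  eqn : C .nat → C .nat → Prop
  std {σ : Ty} : C σ → Prop

/-- Typed assignments of values to the variables of a context. -/
abbrev Env (C : Ty → Type) (Γ : Ctx) : Type := ∀ σ : Ty, Var Γ σ → C σ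

/-- The assignment to no variables. -/
def Env.nil {C : Ty → Type} : Env C [] := fun _ v => by cases v

/-- The assignment extended by a value of the innermost variable. -/
def Env.cons {C : Ty → Type} {Γ : Ctx} {ρ : Ty} (x : C ρ) (e : Env C Γ) : Env C (ρ :: Γ)
  | _, .z => x
  | _, .s v => e _ v

namespace Str

variable (M : Str) {b : Bool}

/-- The value of a term. -/
def eval {Γ : Ctx} (e : Env M.C Γ) : {σ : Ty} → Tm Γ σ → M.C σ
  | _, .var v => e _ v
  | _, .cst c => M.cst c
  | _, .app s t => M.app (eval e s) (eval e t)

/-- Truth of a formula. -/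
def sat : {Γ : Ctx} → Env M.C Γ → Fm b Γ → Prop
  | _, e, .eq s t => M.eqn (M.eval e s) (M.eval e t)
  | _, e, .st _ t => M.std (M.eval e t)
  | _, _, .bot => False
  | _, e, .imp A B => sat e A → sat e B
  | _, e, .all σ A => ∀ x : M.C σ, sat (e.cons x) A

theorem eval_subst {Γ Δ : Ctx} (f : Sub Γ Δ) (e : Env M.C Δ) {σ : Ty} (t : Tm Γ σ) :
    M.eval e (t.subst f) = M.eval (fun _ v => M.eval e (f _ v)) t := by
  induction t with
  | var v => rfl
  | cst c => rfl
  | app a b iha ihb => simp only [Tm.subst, eval, iha, ihb]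

theorem eval_wk {Γ : Ctx} {ρ σ : Ty} (x : M.C ρ) (e : Env M.C Γ) (t : Tm Γ σ) :
    M.eval (e.cons x) t.wk = M.eval e t := by
  rw [Tm.wk, Tm.rename, eval_subst]
  rfl

theorem eval_ofClosed {Γ : Ctx} {σ : Ty} (e : Env M.C Γ) (t : Tm [] σ) :
    M.eval e (Tm.ofClosed t) = M.eval .nil t := by
  rw [Tm.ofClosed, Tm.rename, eval_subst]
  congr
  funext σ v
  cases v

end Str

/-! ### Completeness -/

section Henkin

variable {b : Bool} {Ax : (Γ : Ctx) → Fm b Γ → Prop}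

theorem Prf.mono {Γ : Ctx} {H : List (Fm b Γ)} {A : Fm b Γ} (h : Prf Ax Γ H A) :
    ∀ {H' : List (Fm b Γ)}, H ⊆ H' → Prf Ax Γ H' A := by
  induction h with
  | ax h => exact fun _ => .ax h
  | hyp h => exact fun hs => .hyp (hs h)
  | impI _ ih => exact fun hs => .impI (ih (List.cons_subset_cons _ hs))
  | impE _ _ ih₁ ih₂ => exact fun hs => .impE (ih₁ hs) (ih₂ hs)
  | raa _ ih => exact fun hs => .raa (ih (List.cons_subset_cons _ hs))
  | allI _ ih => exact fun hs => .allI (ih (List.map_subset _ hs))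
  | allE t _ ih => exact fun hs => .allE t (ih hs)

/-- A new variable does not affect consistency, because every type has a closed term. -/
theorem Prf.of_wk {Γ : Ctx} {σ : Ty} {H : List (Fm b Γ)}
    (h : Prf Ax (σ :: Γ) (H.map Fm.wk) .bot) : Prf Ax Γ H .bot :=
  Prf.allE (A := .bot) (Tm.zeroOf σ) (.allI h)

/-- An enumeration of the types. -/
noncomputable def tyEnum : ℕ → Ty := (exists_surjective_nat Ty).choose

theorem tyEnum_surjective : Function.Surjective tyEnum := (exists_surjective_nat Ty).choose_spec

/-- An enumeration of the formulas over a context. -/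
noncomputable def fmEnum (b : Bool) (Γ : Ctx) : ℕ → Fm b Γ :=
  (exists_surjective_nat (Fm b Γ)).choose

theorem fmEnum_surjective (b : Bool) (Γ : Ctx) : Function.Surjective (fmEnum b Γ) :=
  (exists_surjective_nat (Fm b Γ)).choose_spec

/-- The type of the variable that is introduced at stage `n`. The number `n` codes a triple: the
stage and the index of the formula that is treated, and the index of this type. -/
noncomputable def newTy (n : ℕ) : Ty := tyEnum n.unpair.2.unpair.2

/-- The variables available at stage `n`. -/
noncomputable def stage : ℕ → Ctx
  | 0 => []
  | n + 1 => newTy n :: stage n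

/-- The formula treated at stage `n`, a weakening of a formula over an earlier stage. Every formula
of every stage is treated at later stages, and this together with new variables of all types. -/
noncomputable def task (b : Bool) (n : ℕ) : Fm b (stage n) :=
  Nat.leRecOn (C := fun n => Fm b (stage n)) n.unpair_left_le (fun A => A.wk)
    (fmEnum b (stage n.unpair.1) n.unpair.2.unpair.1)

open Classical in
/-- `H` extended by `A` or by its negation. -/
noncomputable def decideFm (Ax : (Γ : Ctx) → Fm b Γ → Prop) {Γ : Ctx} (H : List (Fm b Γ))
    (A : Fm b Γ) : List (Fm b Γ) :=
  if Prf Ax Γ H A then A :: H else A.neg :: H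

open Classical in
/-- `H` extended by `A` or by its negation, and by a counterexample in the new variable if `A` is
a universal formula that does not follow from `H`. -/
noncomputable def extendFm (Ax : (Γ : Ctx) → Fm b Γ → Prop) {Γ : Ctx} (σ : Ty) (H : List (Fm b Γ))
    (A : Fm b Γ) : List (Fm b (σ :: Γ)) :=
  if h : ∃ B, A = .all σ B ∧ ¬ Prf Ax Γ H A then h.choose.neg :: (decideFm Ax H A).map Fm.wk
  else (decideFm Ax H A).map Fm.wk

theorem decideFm_consistent {Γ : Ctx} {H : List (Fm b Γ)} (A : Fm b Γ) (h : ¬ Prf Ax Γ H .bot) :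
    ¬ Prf Ax Γ (decideFm Ax H A) .bot := by
  unfold decideFm
  split_ifs with hA
  · exact fun h' => h (.impE (.impI h') hA)
  · exact fun h' => hA (.raa h')

theorem extendFm_consistent {Γ : Ctx} {σ : Ty} {H : List (Fm b Γ)} (A : Fm b Γ)
    (h : ¬ Prf Ax Γ H .bot) : ¬ Prf Ax (σ :: Γ) (extendFm Ax σ H A) .bot := by
  unfold extendFm
  split_ifs with hA
  · intro h'
    have h₁ := Prf.allI (Prf.raa h')
    rw [← hA.choose_spec.1] at h₁
    unfold decideFm at h₁
    rw [if_neg hA.choose_spec.2] at h₁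
    exact hA.choose_spec.2 (.raa (.impE (.hyp (by simp)) h₁))
  · exact fun h' => decideFm_consistent A h h'.of_wk

/-- The assumptions collected up to stage `n`, starting from the negation of `A`. -/
noncomputable def theory (Ax : (Γ : Ctx) → Fm b Γ → Prop) (A : Fm b []) :
    (n : ℕ) → List (Fm b (stage n))
  | 0 => [A.neg]
  | n + 1 => extendFm Ax (newTy n) (theory Ax A n) (task b n)

variable {A₀ : Fm b []}

theorem theory_consistent (h : ¬ Provable Ax A₀) (n : ℕ) :
    ¬ Prf Ax (stage n) (theory Ax A₀ n) .bot := by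
  induction n with
  | zero => exact fun h' => h (.raa h')
  | succ n ih => exact extendFm_consistent _ ih

theorem mem_extendFm {Γ : Ctx} {σ : Ty} {H : List (Fm b Γ)} {A B : Fm b Γ}
    (h : B ∈ decideFm Ax H A) : B.wk ∈ extendFm Ax σ H A := by
  unfold extendFm
  split_ifs
  · exact List.mem_cons_of_mem _ (List.mem_map_of_mem h)
  · exact List.mem_map_of_mem h

theorem wk_mem_theory {n : ℕ} {A : Fm b (stage n)} (h : A ∈ theory Ax A₀ n) :
    A.wk ∈ theory Ax A₀ (n + 1) := by
  refine mem_extendFm ?_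
  unfold decideFm
  split_ifs <;> exact List.mem_cons_of_mem _ h

/-- A family of formulas, one for each stage, that is eventually given by weakening. -/
def Coherent (A : ∀ n, Fm b (stage n)) : Prop := ∀ᶠ n in Filter.atTop, A (n + 1) = (A n).wk

/-- A coherent family is treated at some late stage, with a new variable of any given type. -/
theorem Coherent.exists_task {A : ∀ n, Fm b (stage n)} (hA : Coherent A) (σ : Ty) :
    ∀ N, ∃ n ≥ N, newTy n = σ ∧ task b n = A n ∧ ∀ m ≥ n, A (m + 1) = (A m).wk := by
  intro N
  obtain ⟨N', hN'⟩ := Filter.eventually_atTop.1 hA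
  obtain ⟨i, hi⟩ := fmEnum_surjective b (stage (max N N')) (A (max N N'))
  obtain ⟨j, hj⟩ := tyEnum_surjective σ
  set m := max N N' with hm
  have hmn : m ≤ Nat.pair m (Nat.pair i j) := Nat.left_le_pair _ _
  refine ⟨Nat.pair m (Nat.pair i j), le_trans (le_max_left _ _) hmn, ?_, ?_, ?_⟩
  · simp [newTy, hj]
  · have key : ∀ n, ∀ h : m ≤ n, Nat.leRecOn (C := fun n => Fm b (stage n)) h
        (fun A => A.wk) (A m) = A n := by
      intro n h
      induction n, h using Nat.le_induction with
      | base => exact Nat.leRecOn_self _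
      | succ n h ih =>
        refine (Nat.leRecOn_succ (C := fun n => Fm b (stage n)) h _).trans ?_
        rw [ih, hN' n (le_trans (le_max_right _ _) h)]
    have : ∀ k l : ℕ, ∀ h : k ≤ Nat.pair m (Nat.pair i j), k = m → l = i →
        Nat.leRecOn (C := fun n => Fm b (stage n)) h (fun A => A.wk)
          (fmEnum b (stage k) l) = A _ := by
      rintro k l h rfl rfl
      rw [hi]
      exact key _ h
    exact this _ _ _ (by simp) (by simp)
  · exact fun k hk => hN' k (le_trans (le_max_right _ _) (le_trans hmn hk))

variable (Ax A₀) in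
/-- The coherent family belongs to the limit theory. -/
def InLimit (A : ∀ n, Fm b (stage n)) : Prop := ∀ᶠ n in Filter.atTop, A n ∈ theory Ax A₀ n

theorem InLimit.of_mem {A : ∀ n, Fm b (stage n)} {n : ℕ} (hA : ∀ m ≥ n, A (m + 1) = (A m).wk)
    (h : A n ∈ theory Ax A₀ n) : InLimit Ax A₀ A := by
  refine Filter.eventually_atTop.2 ⟨n, fun m hm => ?_⟩
  induction m, hm using Nat.le_induction with
  | base => exact h
  | succ m hm ih => rw [hA m hm]; exact wk_mem_theory ih

theorem Coherent.inLimit_or {A : ∀ n, Fm b (stage n)} (hA : Coherent A) :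
    InLimit Ax A₀ A ∨ InLimit Ax A₀ fun n => (A n).neg := by
  obtain ⟨n, -, -, h₁, h₂⟩ := hA.exists_task .nat 0
  have key : A n ∈ decideFm Ax (theory Ax A₀ n) (task b n) ∨
      (A n).neg ∈ decideFm Ax (theory Ax A₀ n) (task b n) := by
    rw [h₁]
    unfold decideFm
    split_ifs <;> simp
  rcases key with h | h
  · refine .inl (.of_mem (n := n + 1) (fun m hm => h₂ m (by omega)) ?_)
    rw [h₂ n le_rfl]
    exact mem_extendFm h
  · refine .inr (.of_mem (n := n + 1) (fun m hm => ?_) ?_)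
    · rw [h₂ m (by omega)]; rfl
    · rw [h₂ n le_rfl]
      exact mem_extendFm h

theorem InLimit.false_of_prf (h₀ : ¬ Provable Ax A₀)
    (h : ∀ᶠ n in Filter.atTop, Prf Ax (stage n) (theory Ax A₀ n) .bot) : False := by
  obtain ⟨n, hn⟩ := h.exists
  exact theory_consistent h₀ n hn

/-- The limit theory is deductively closed. -/
theorem Coherent.inLimit_of_prf (h₀ : ¬ Provable Ax A₀) {A : ∀ n, Fm b (stage n)} (hA : Coherent A)
    (h : ∀ᶠ n in Filter.atTop, Prf Ax (stage n) (theory Ax A₀ n) (A n)) : InLimit Ax A₀ A := by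
  refine hA.inLimit_or.resolve_right fun h' => InLimit.false_of_prf (Ax := Ax) h₀ ?_
  filter_upwards [h, h'] with n h₁ h₂ using .impE (.hyp h₂) h₁

/-- The universal formulas outside the limit theory have counterexamples. -/
theorem Coherent.exists_witness {σ : Ty} {B : ∀ n, Fm b (σ :: stage n)}
    (hA : Coherent fun n => .all σ (B n))
    (h : ¬ InLimit Ax A₀ fun n => .all σ (B n)) (N : ℕ) :
    ∃ n ≥ N, ∃ hn : newTy n = σ, (hn.symm ▸ (B n).neg : Fm b (newTy n :: stage n)) ∈
      theory Ax A₀ (n + 1) := by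
  obtain ⟨n, hN, rfl, h₁, h₂⟩ := hA.exists_task σ N
  refine ⟨n, hN, rfl, ?_⟩
  have hnot : ¬ Prf Ax (stage n) (theory Ax A₀ n) (.all _ (B n)) := by
    intro hp
    refine h (.of_mem (n := n + 1) (fun m hm => h₂ m (by omega)) ?_)
    rw [h₂ n le_rfl]
    refine mem_extendFm ?_
    unfold decideFm
    rw [h₁, if_pos hp]
    simp
  have hex : ∃ C, task b n = .all (newTy n) C ∧ ¬ Prf Ax (stage n) (theory Ax A₀ n) (task b n) :=
    ⟨B n, h₁, h₁ ▸ hnot⟩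
  have hC : hex.choose = B n := by
    have := hex.choose_spec.1.symm.trans h₁
    simpa using this
  show _ ∈ extendFm _ _ _ _
  unfold extendFm
  rw [dif_pos hex, hC]
  simp

/-- The elements of the term model: families of terms that are eventually given by weakening. -/
def Elt (σ : Ty) : Type :=
  {t : ∀ n, Tm (stage n) σ // ∀ᶠ n in Filter.atTop, t (n + 1) = (t n).wk}

variable (Ax A₀) in
/-- The term model of the limit theory. -/
noncomputable def termStr : Str where
  C := Elt
  app f x := ⟨fun n => f.1 n ⬝ x.1 n, by
    filter_upwards [f.2, x.2] with n h₁ h₂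
    rw [h₁, h₂]; rfl⟩
  cst c := ⟨fun _ => .cst c, .of_forall fun _ => rfl⟩
  eqn x y := InLimit Ax A₀ fun n => .eq (x.1 n) (y.1 n)
  std x := ∃ h : b = true, InLimit Ax A₀ fun n => .st h (x.1 n)

/-- The substitution that an assignment of elements gives at stage `n`. -/
def Env.at {Γ : Ctx} (e : Env Elt Γ) (n : ℕ) : Sub Γ (stage n) := fun σ v => (e σ v).1 n

theorem Env.at_succ {Γ : Ctx} (e : Env Elt Γ) :
    ∀ᶠ n in Filter.atTop, ∀ σ v, e.at (n + 1) σ v = (e.at n σ v).wk := by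
  induction Γ with
  | nil => exact .of_forall fun n σ v => by cases v
  | cons ρ Γ ih =>
    filter_upwards [ih fun σ v => e σ (.s v), (e ρ .z).2] with n h₁ h₂ σ v
    cases v with
    | z => exact h₂
    | s v => exact h₁ σ v

theorem eval_termStr {Γ : Ctx} (e : Env Elt Γ) {σ : Ty} (t : Tm Γ σ) (n : ℕ) :
    ((termStr Ax A₀).eval e t).1 n = t.subst (e.at n) := by
  induction t with
  | var v => rfl
  | cst c => rfl
  | app s t ihs iht =>
    show _ ⬝ _ = _
    rw [ihs, iht]; rfl

theorem Fm.subst_at_succ {Γ : Ctx} {e : Env Elt Γ} {n : ℕ}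
    (h : ∀ σ v, e.at (n + 1) σ v = (e.at n σ v).wk) (A : Fm b Γ) :
    A.subst (e.at (n + 1)) = (A.subst (e.at n)).wk := by
  rw [Fm.wk, Fm.rename, Fm.subst_subst]
  congr
  funext σ v
  exact h σ v

theorem coherent_subst {Γ : Ctx} (e : Env Elt Γ) (A : Fm b Γ) :
    Coherent fun n => A.subst (e.at n) := by
  filter_upwards [e.at_succ] with n h using A.subst_at_succ h

theorem Fm.subst_lift_inst {Γ Δ : Ctx} {ρ : Ty} (A : Fm b (ρ :: Γ)) (f : Sub Γ Δ) (t : Tm Δ ρ)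
    {g : Sub (ρ :: Γ) Δ} (hz : g _ .z = t) (hs : ∀ σ v, g σ (.s v) = f σ v) :
    (A.subst (f.lift ρ)).inst t = A.subst g := by
  rw [Fm.inst, Fm.subst_subst]
  congr
  funext σ v
  cases v with
  | z => exact hz.symm
  | s v => exact (Tm.wk_subst_one _ _).trans (hs _ v).symm

/-- The variable introduced at stage `n`, as an element. Its values at the stages up to `n`, where
this variable does not exist yet, are irrelevant. -/
noncomputable def newElt (n : ℕ) : Elt (newTy n) :=
  ⟨fun m => Nat.rec (motive := fun m => Tm (stage m) (newTy n)) (Tm.zeroOf _)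
    (fun m t => if h : m = n then (h ▸ (.var .z : Tm (stage (m + 1)) (newTy m))) else t.wk) m, by
    filter_upwards [Filter.eventually_gt_atTop n] with m hm
    exact dif_neg hm.ne'⟩

theorem newElt_wk {n m : ℕ} (h : n < m) : (newElt n).1 (m + 1) = ((newElt n).1 m).wk :=
  dif_neg h.ne'

theorem newElt_succ (n : ℕ) : (newElt n).1 (n + 1) = .var .z := dif_pos rfl

/-- Truth in the term model is membership in the limit theory. -/
theorem sat_termStr (h₀ : ¬ Provable Ax A₀) {Γ : Ctx} (A : Fm b Γ) (e : Env Elt Γ) :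
    (termStr Ax A₀).sat e A ↔ InLimit Ax A₀ fun n => A.subst (e.at n) := by
  induction A with
  | eq s t =>
    show InLimit Ax A₀ _ ↔ _
    simp only [eval_termStr]; rfl
  | st h t =>
    show (∃ h : b = true, InLimit Ax A₀ _) ↔ _
    simp only [eval_termStr, h, exists_true_left]; rfl
  | bot =>
    refine ⟨False.elim, fun h => InLimit.false_of_prf (Ax := Ax) h₀ ?_⟩
    filter_upwards [h] with n hn using .hyp hn
  | imp A B ihA ihB =>
    show (_ → _) ↔ _
    rw [ihA, ihB]
    constructor
    · intro h
      refine (coherent_subst e (.imp A B)).inLimit_of_prf h₀ ?_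
      rcases (coherent_subst e A).inLimit_or (Ax := Ax) (A₀ := A₀) with h' | h'
      · filter_upwards [h h'] with n hn using .impI (.hyp (List.mem_cons_of_mem _ hn))
      · filter_upwards [h'] with n hn
        exact .impI (.raa (.impE (.hyp (by simp [hn])) (.hyp (A := A.subst (e.at n)) (by simp))))
    · intro h h'
      refine (coherent_subst e B).inLimit_of_prf h₀ ?_
      filter_upwards [h, h'] with n h₁ h₂ using .impE (.hyp h₁) (.hyp h₂)
  | all σ A ih =>
    refine (forall_congr' fun x : Elt σ => ih (e.cons x)).trans ?_
    constructor
    · intro h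
      by_contra hn
      -- The new variable of a late stage at which the formula is treated is a counterexample.
      obtain ⟨N, hN⟩ := Filter.eventually_atTop.1 e.at_succ
      obtain ⟨n, hnN, rfl, hmem⟩ := (coherent_subst e (.all σ A)).exists_witness hn N
      refine InLimit.false_of_prf (Ax := Ax) (A₀ := A₀) h₀ ?_
      have hw : A.subst ((e.at n).lift _) = A.subst ((e.cons (newElt n)).at (n + 1)) := by
        congr
        funext σ v
        cases v with
        | z => exact (newElt_succ n).symm
        | s v => exact (hN n hnN _ v).symm
      have hneg : InLimit Ax A₀ fun m => (A.subst ((e.cons (newElt n)).at m)).neg := by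
        refine .of_mem (n := n + 1) (fun m hm => ?_) (hw ▸ hmem)
        refine congrArg Fm.neg (A.subst_at_succ fun σ v => ?_)
        cases v with
        | z => exact newElt_wk hm
        | s v => exact hN m (by omega) _ v
      filter_upwards [h (newElt n), hneg] with m h₁ h₂ using .impE (.hyp h₂) (.hyp h₁)
    · intro h d
      refine (coherent_subst (e.cons d) A).inLimit_of_prf h₀ ?_
      filter_upwards [h] with n hn
      rw [← Fm.subst_lift_inst A (e.at n) (d.1 n) rfl fun _ _ => rfl]
      exact .allE _ (.hyp hn)

end Henkin

/-- Completeness: an unprovable sentence fails in a structure that satisfies all formulas whose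
substitution instances are provable. -/
theorem exists_termStr {b : Bool} {Ax : (Γ : Ctx) → Fm b Γ → Prop} {A₀ : Fm b []}
    (h₀ : ¬ Provable Ax A₀) : ∃ M : Str, ¬ M.sat .nil A₀ ∧
      ∀ {Γ : Ctx} (A : Fm b Γ), (∀ (Δ : Ctx) (f : Sub Γ Δ), Prf Ax Δ [] (A.subst f)) →
        ∀ e : Env M.C Γ, M.sat e A := by
  refine ⟨termStr Ax A₀, fun h => ?_, fun A hA e => (sat_termStr h₀ A e).2 ?_⟩
  · have h₁ : InLimit Ax A₀ fun n => (A₀.subst ((Env.nil : Env Elt []).at n)).neg := by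
      refine .of_mem (n := 0) (fun m _ => ?_) ?_
      · exact congrArg Fm.neg (A₀.subst_at_succ fun σ v => by cases v)
      · have : A₀.subst ((Env.nil : Env Elt []).at 0) = A₀ := by
          conv_rhs => rw [← Fm.subst_var A₀]
          congr
          funext σ v
          cases v
        show Fm.neg _ ∈ [A₀.neg]
        rw [this]
        exact List.mem_singleton_self _
    refine InLimit.false_of_prf (Ax := Ax) h₀ ?_
    filter_upwards [(sat_termStr h₀ A₀ .nil).1 h, h₁] with n h₁ h₂ using .impE (.hyp h₂) (.hyp h₁)
  · exact (coherent_subst e A).inLimit_of_prf h₀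
      (.of_forall fun n => (hA _ _).mono (List.nil_subset _))

/-! ### Extensional models -/

/-- The image of an assignment. -/
def Env.map {C D : Ty → Type} (g : ∀ σ, C σ → D σ) {Γ : Ctx} (e : Env C Γ) : Env D Γ :=
  fun σ v => g σ (e σ v)

theorem Env.map_cons {C D : Ty → Type} (g : ∀ σ, C σ → D σ) {Γ : Ctx} {ρ : Ty} (x : C ρ)
    (e : Env C Γ) : (e.cons x).map g = (e.map g).cons (g ρ x) := by
  funext σ v
  cases v <;> rfl

theorem Env.exists_map_eq {C D : Ty → Type} {g : ∀ σ, C σ → D σ}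
    (hg : ∀ σ, Function.Surjective (g σ)) {Γ : Ctx} (e : Env D Γ) : ∃ e', Env.map g e' = e :=
  ⟨fun σ v => (hg σ (e σ v)).choose, funext fun σ => funext fun v => (hg σ (e σ v)).choose_spec⟩

namespace Str

variable {b : Bool}

@[simp] theorem sat_eq (M : Str) {Γ : Ctx} (e : Env M.C Γ) (s t : Tm Γ .nat) :
    M.sat e (.eq s t : Fm b Γ) ↔ M.eqn (M.eval e s) (M.eval e t) := Iff.rfl

@[simp] theorem sat_st (M : Str) {Γ : Ctx} (e : Env M.C Γ) {σ : Ty} (h : b = true) (t : Tm Γ σ) :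
    M.sat e (.st h t : Fm b Γ) ↔ M.std (M.eval e t) := Iff.rfl

@[simp] theorem sat_bot (M : Str) {Γ : Ctx} (e : Env M.C Γ) : M.sat e (.bot : Fm b Γ) ↔ False :=
  Iff.rfl

@[simp] theorem sat_imp (M : Str) {Γ : Ctx} (e : Env M.C Γ) (A B : Fm b Γ) :
    M.sat e (.imp A B) ↔ (M.sat e A → M.sat e B) := Iff.rfl

@[simp] theorem sat_all (M : Str) {Γ : Ctx} (e : Env M.C Γ) {σ : Ty} (A : Fm b (σ :: Γ)) :
    M.sat e (.all σ A) ↔ ∀ x : M.C σ, M.sat (e.cons x) A := Iff.rfl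

theorem sat_and (M : Str) {Γ : Ctx} (e : Env M.C Γ) (A B : Fm b Γ) :
    M.sat e (.and A B) ↔ M.sat e A ∧ M.sat e B := by
  simp

theorem sat_ex (M : Str) {Γ : Ctx} (e : Env M.C Γ) {σ : Ty} (A : Fm b (σ :: Γ)) :
    M.sat e (.ex σ A) ↔ ∃ x : M.C σ, M.sat (e.cons x) A := by
  simp

theorem sat_iff (M : Str) {Γ : Ctx} (e : Env M.C Γ) (A B : Fm b Γ) :
    M.sat e (.iff A B) ↔ (M.sat e A ↔ M.sat e B) := by
  rw [Fm.iff, sat_and, sat_imp, sat_imp]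
  exact iff_iff_implies_and_implies.symm

@[simp] theorem eval_var (M : Str) {Γ : Ctx} (e : Env M.C Γ) {σ : Ty} (v : Var Γ σ) :
    M.eval e (.var v) = e _ v := rfl

@[simp] theorem eval_cst (M : Str) {Γ : Ctx} (e : Env M.C Γ) {σ : Ty} (c : Cst σ) :
    M.eval e (.cst c) = M.cst c := rfl

@[simp] theorem eval_app (M : Str) {Γ : Ctx} (e : Env M.C Γ) {σ τ : Ty} (s : Tm Γ (σ ⇒ τ))
    (t : Tm Γ σ) : M.eval e (s ⬝ t) = M.app (M.eval e s) (M.eval e t) := rfl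

/-- `i < n`, as the formula `Fm.lt` expresses it. -/
def lt (M : Str) (i n : M.C .nat) : Prop :=
  M.eqn (M.app (M.app (M.eval .nil Tm.monus) (M.app (M.cst .succ) i)) n) (M.cst .zero)

/-- Extensional equality of elements. -/
def Eqv (M : Str) : (σ : Ty) → M.C σ → M.C σ → Prop
  | .nat, x, y => M.eqn x y
  | .arr σ τ, f, g => ∀ x : M.C σ, M.Eqv τ (M.app f x) (M.app g x)
  | .seq σ, s, t => M.eqn (M.app (M.cst (.len σ)) s) (M.app (M.cst (.len σ)) t) ∧
      ∀ i, M.lt i (M.app (M.cst (.len σ)) s) →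
        M.Eqv σ (M.app (M.app (M.cst (.get σ)) s) i) (M.app (M.app (M.cst (.get σ)) t) i)

theorem sat_eqOf (M : Str) {Γ : Ctx} (e : Env M.C Γ) {σ : Ty} (s t : Tm Γ σ) :
    M.sat e (Fm.eqOf (b := b) σ s t) ↔ M.Eqv σ (M.eval e s) (M.eval e t) := by
  induction σ generalizing Γ with
  | nat => rfl
  | arr σ τ _ ih => simp [Fm.eqOf, ih, Eqv, eval_wk, Env.cons]
  | seq σ ih =>
    rw [Fm.eqOf, sat_and]
    simp only [sat_all, sat_imp, sat_eq, ih, Eqv, eval_app, eval_cst, eval_var, eval_wk]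
    rfl

/-- The laws of equality. -/
structure EqLaws (M : Str) : Prop where
  refl (x : M.C .nat) : M.eqn x x
  symm {x y : M.C .nat} : M.eqn x y → M.eqn y x
  trans {x y z : M.C .nat} : M.eqn x y → M.eqn y z → M.eqn x z
  ext {ρ τ : Ty} {x y : M.C ρ} (f : M.C (ρ ⇒ τ)) :
    M.Eqv ρ x y → M.Eqv τ (M.app f x) (M.app f y)

namespace EqLaws

variable {M : Str}

theorem eqv_refl (h : M.EqLaws) {σ : Ty} (x : M.C σ) : M.Eqv σ x x := by
  induction σ with
  | nat => exact h.refl x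
  | arr σ τ _ ih => exact fun y => ih _
  | seq σ ih => exact ⟨h.refl _, fun i _ => ih _⟩

theorem lt_congr (h : M.EqLaws) {i m n : M.C .nat} (hmn : M.eqn m n) (hi : M.lt i m) : M.lt i n :=
  h.trans (h.ext (ρ := .nat) (τ := .nat) _ (h.symm hmn)) hi

theorem eqv_symm (h : M.EqLaws) {σ : Ty} {x y : M.C σ} (hxy : M.Eqv σ x y) : M.Eqv σ y x := by
  induction σ with
  | nat => exact h.symm hxy
  | arr σ τ _ ih => exact fun z => ih (hxy z)
  | seq σ ih =>
    exact ⟨h.symm hxy.1, fun i hi => ih (hxy.2 i (h.lt_congr (h.symm hxy.1) hi))⟩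

theorem eqv_trans (h : M.EqLaws) {σ : Ty} {x y z : M.C σ} (hxy : M.Eqv σ x y) (hyz : M.Eqv σ y z) :
    M.Eqv σ x z := by
  induction σ with
  | nat => exact h.trans hxy hyz
  | arr σ τ _ ih => exact fun w => ih (hxy w) (hyz w)
  | seq σ ih =>
    exact ⟨h.trans hxy.1 hyz.1,
      fun i hi => ih (hxy.2 i hi) (hyz.2 i (h.lt_congr hxy.1 hi))⟩

theorem eqv_app (h : M.EqLaws) {σ τ : Ty} {f g : M.C (σ ⇒ τ)} {x y : M.C σ} (hf : M.Eqv _ f g)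
    (hx : M.Eqv _ x y) : M.Eqv τ (M.app f x) (M.app g y) :=
  h.eqv_trans (h.ext f hx) (hf y)

end EqLaws

/-- Extensional equality as a setoid. -/
def setoid (M : Str) (h : M.EqLaws) (σ : Ty) : Setoid (M.C σ) :=
  ⟨M.Eqv σ, h.eqv_refl, h.eqv_symm, h.eqv_trans⟩

/-- The quotient of a structure by extensional equality. -/
def quot (M : Str) (h : M.EqLaws) : Str where
  C σ := Quotient (M.setoid h σ)
  app := Quotient.map₂ M.app fun _ _ hf _ _ hx => h.eqv_app hf hx
  cst c := Quotient.mk _ (M.cst c)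
  eqn x y := x = y
  std x := ∃ y, Quotient.mk _ y = x ∧ M.std y

/-- The projection to the quotient. -/
def proj (M : Str) (h : M.EqLaws) (σ : Ty) (x : M.C σ) : (M.quot h).C σ :=
  Quotient.mk (M.setoid h σ) x

theorem proj_eq_iff {M : Str} (h : M.EqLaws) {σ : Ty} {x y : M.C σ} :
    M.proj h σ x = M.proj h σ y ↔ M.Eqv σ x y :=
  Quotient.eq (r := M.setoid h σ)

theorem proj_surjective (M : Str) (h : M.EqLaws) (σ : Ty) : Function.Surjective (M.proj h σ) :=
  Quotient.mk_surjective

theorem eval_quot {M : Str} (h : M.EqLaws) {Γ : Ctx} (e : Env M.C Γ) {σ : Ty} (t : Tm Γ σ) :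
    (M.quot h).eval (e.map (M.proj h)) t = M.proj h σ (M.eval e t) := by
  induction t with
  | var v => rfl
  | cst c => rfl
  | app s t ihs iht =>
    rw [eval_app, ihs, iht]; rfl

/-- Passing to the quotient does not affect truth. -/
theorem sat_quot {M : Str} (h : M.EqLaws)
    (hst : b = true → ∀ {σ : Ty} {x y : M.C σ}, M.std x → M.Eqv σ x y → M.std y)
    {Γ : Ctx} (A : Fm b Γ) (e : Env M.C Γ) :
    (M.quot h).sat (e.map (M.proj h)) A ↔ M.sat e A := by
  induction A with
  | eq s t =>
    rw [sat_eq, eval_quot, eval_quot]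
    exact proj_eq_iff h
  | @st Γ σ hb t =>
    rw [sat_st, eval_quot]
    exact ⟨fun ⟨y, hy, hs⟩ => hst ‹_› hs ((proj_eq_iff h).1 hy), fun hs => ⟨_, rfl, hs⟩⟩
  | bot => rfl
  | imp A B ihA ihB => rw [sat_imp, sat_imp, ihA, ihB]
  | all σ A ih =>
    rw [sat_all, sat_all, (M.proj_surjective h σ).forall]
    refine forall_congr' fun x => ?_
    rw [← ih, Env.map_cons]

end Str

/-- The structures with extensional equality that satisfy the axioms of `RCA₀^ω` on the combinators, on
recursion and on quantifier-free induction, the latter for implications between equations. -/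
structure Model extends Str where
  eqn_iff (x y : C .nat) : eqn x y ↔ x = y
  app_ext {σ τ : Ty} (f g : C (σ ⇒ τ)) : (∀ x, app f x = app g x) → f = g
  app_K {σ τ : Ty} (x : C σ) (y : C τ) : app (app (cst (.K σ τ)) x) y = x
  app_S {ρ σ τ : Ty} (x : C (ρ ⇒ σ ⇒ τ)) (y : C (ρ ⇒ σ)) (z : C ρ) :
    app (app (app (cst (.S ρ σ τ)) x) y) z = app (app x z) (app y z)
  rec_zero (y : C .nat) (z : C (.nat ⇒ .nat ⇒ .nat)) :
    app (app (app (cst .R) (cst .zero)) y) z = y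
  rec_succ (x y : C .nat) (z : C (.nat ⇒ .nat ⇒ .nat)) :
    app (app (app (cst .R) (app (cst .succ) x)) y) z =
      app (app z (app (app (app (cst .R) x) y) z)) x
  succ_ne_zero (x : C .nat) : app (cst .succ) x ≠ cst .zero
  succ_inj (x y : C .nat) : app (cst .succ) x = app (cst .succ) y → x = y
  imp_ind (f g h k : C one) : (app f (cst .zero) = app g (cst .zero) →
      app h (cst .zero) = app k (cst .zero)) →
    (∀ n, (app f n = app g n → app h n = app k n) →
      app f (app (cst .succ) n) = app g (app (cst .succ) n) →
      app h (app (cst .succ) n) = app k (app (cst .succ) n)) →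
    ∀ n, app f n = app g n → app h n = app k n

open Tm Fm in
/-- Completeness with respect to extensional models. If `st` belongs to the language, then it has to
respect extensional equality, in order to be defined on the quotient. -/
theorem exists_model {b : Bool} {Ax : (Γ : Ctx) → Fm b Γ → Prop} {A₀ : Fm b []}
    (hAx : ∀ {Γ : Ctx} {A : Fm b Γ}, RCAomega b Γ A → Ax Γ A)
    (hst : ∀ (h : b = true) {Γ : Ctx} {σ : Ty} (x y : Tm Γ σ),
      Ax Γ (.imp (.st h x) (.imp (eqOf σ x y) (.st h y))))
    (h₀ : ¬ Provable Ax A₀) : ∃ M : Model, ¬ M.sat .nil A₀ ∧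
      ∀ {Γ : Ctx} (A : Fm b Γ), (∀ (Δ : Ctx) (f : Sub Γ Δ), Prf Ax Δ [] (A.subst f)) →
        ∀ e : Env M.C Γ, M.sat e A := by
  obtain ⟨M, hM₀, hM⟩ := exists_termStr h₀
  have hE : M.EqLaws := by
    refine ⟨fun x => ?_, fun {x y} => ?_, fun {x y z} => ?_, fun {ρ τ x y} f => ?_⟩
    · exact hM (Γ := [.nat]) (.eq v0 v0) (fun Δ f => .ax (hAx (.eq_refl _))) (Env.nil.cons x)
    · exact hM (Γ := [.nat, .nat]) (.imp (.eq v1 v0) (.eq v0 v1))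
        (fun Δ f => .ax (hAx (.eq_symm _ _))) ((Env.nil.cons x).cons y)
    · exact hM (Γ := [.nat, .nat, .nat]) (.imp (.eq v2 v1) (.imp (.eq v1 v0) (.eq v2 v0)))
        (fun Δ f => .ax (hAx (.eq_trans _ _ _))) (((Env.nil.cons x).cons y).cons z)
    · have := hM (Γ := [ρ ⇒ τ, ρ, ρ]) (.imp (eqOf ρ v2 v1) (eqOf τ (v0 ⬝ v2) (v0 ⬝ v1)))
        (fun Δ g => by
          simp only [Fm.subst, eqOf_subst]
          exact .ax (hAx (.ext _ _ _))) (((Env.nil.cons x).cons y).cons f)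
      simp only [Str.sat_imp, Str.sat_eqOf] at this
      exact this
  have hS : b = true → ∀ {σ : Ty} {x y : M.C σ}, M.std x → M.Eqv σ x y → M.std y := by
    intro hb σ x y
    have := hM (Γ := [σ, σ]) (.imp (.st hb v1) (.imp (eqOf σ v1 v0) (.st hb v0)))
        (fun Δ g => by
          simp only [Fm.subst, eqOf_subst]
          exact .ax (hst _ _ _)) ((Env.nil.cons x).cons y)
    simp only [Str.sat_imp, Str.sat_eqOf] at this
    exact this
  have hQ : ∀ {Γ : Ctx} (A : Fm b Γ), (∀ (Δ : Ctx) (f : Sub Γ Δ), Prf Ax Δ [] (A.subst f)) →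
      ∀ e : Env (M.quot hE).C Γ, (M.quot hE).sat e A := by
    intro Γ A hA e
    obtain ⟨e, rfl⟩ := Env.exists_map_eq (M.proj_surjective hE) e
    exact (Str.sat_quot hE hS A e).2 (hM A hA _)
  have hE' : ∀ {σ : Ty} {x y : (M.quot hE).C σ}, (M.quot hE).Eqv σ x y → x = y := by
    intro σ x y h
    obtain ⟨x, rfl⟩ := M.proj_surjective hE σ x
    obtain ⟨y, rfl⟩ := M.proj_surjective hE σ y
    have h' := (Str.sat_eqOf (b := b) (M.quot hE)
      (((Env.nil.cons x).cons y).map (M.proj hE)) v1 v0).2 h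
    rw [Str.sat_quot hE hS, Str.sat_eqOf] at h'
    exact (Str.proj_eq_iff hE).2 h'
  refine ⟨⟨M.quot hE, ?_, ?_, ?_, ?_, ?_, ?_, ?_, ?_, ?_⟩, ?_, hQ⟩
  · exact fun x y => Iff.rfl
  · intro σ τ f g h
    refine hE' fun x => ?_
    rw [h x]
    have hr : ∀ {σ : Ty} (x : (M.quot hE).C σ), (M.quot hE).Eqv σ x x := by
      intro σ x
      induction σ with
      | nat => exact rfl
      | arr σ τ _ ih => exact fun y => ih _
      | seq σ ih => exact ⟨rfl, fun i _ => ih _⟩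
    exact hr _
  · intro σ τ x y
    have := hQ (Γ := [τ, σ]) (eqOf σ (.cst (.K σ τ) ⬝ v1 ⬝ v0) v1)
      (fun Δ g => by
        simp only [eqOf_subst]
        exact .ax (hAx (.comb_K _ _))) ((Env.nil.cons x).cons y)
    rw [Str.sat_eqOf] at this
    exact hE' this
  · intro ρ σ τ x y z
    have := hQ (Γ := [ρ, ρ ⇒ σ, ρ ⇒ σ ⇒ τ])
      (eqOf τ (.cst (.S ρ σ τ) ⬝ v2 ⬝ v1 ⬝ v0) (v2 ⬝ v0 ⬝ (v1 ⬝ v0)))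
      (fun Δ g => by
        simp only [eqOf_subst]
        exact .ax (hAx (.comb_S _ _ _))) (((Env.nil.cons x).cons y).cons z)
    rw [Str.sat_eqOf] at this
    exact hE' this
  · intro y z
    exact hQ (Γ := [.nat ⇒ .nat ⇒ .nat, .nat]) (.eq (rc zero v1 v0) v1)
      (fun Δ g => .ax (hAx (.rec_zero _ _))) ((Env.nil.cons y).cons z)
  · intro x y z
    exact hQ (Γ := [.nat ⇒ .nat ⇒ .nat, .nat, .nat])
      (.eq (rc (suc v2) v1 v0) (v0 ⬝ rc v2 v1 v0 ⬝ v2))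
      (fun Δ g => .ax (hAx (.rec_succ _ _ _))) (((Env.nil.cons x).cons y).cons z)
  · intro x
    exact hQ (Γ := [.nat]) (.neg (.eq (suc v0) zero))
      (fun Δ g => .ax (hAx (.succ_ne_zero _))) (Env.nil.cons x)
  · intro x y
    exact hQ (Γ := [.nat, .nat]) (.imp (.eq (suc v1) (suc v0)) (.eq v1 v0))
      (fun Δ g => .ax (hAx (.succ_inj _ _))) ((Env.nil.cons x).cons y)
  · intro f g h k
    refine hQ (Γ := [FT.one, FT.one, FT.one, FT.one])
      (.imp (.imp (.eq (v3 ⬝ zero) (v2 ⬝ zero)) (.eq (v1 ⬝ zero) (v0 ⬝ zero)))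
        (.imp (.all .nat (.imp
            (.imp (.eq (.var (.s (.s (.s (.s .z)))) ⬝ v0) (v3 ⬝ v0)) (.eq (v2 ⬝ v0) (v1 ⬝ v0)))
            (.imp (.eq (.var (.s (.s (.s (.s .z)))) ⬝ suc v0) (v3 ⬝ suc v0))
              (.eq (v2 ⬝ suc v0) (v1 ⬝ suc v0)))))
          (.all .nat
            (.imp (.eq (.var (.s (.s (.s (.s .z)))) ⬝ v0) (v3 ⬝ v0)) (.eq (v2 ⬝ v0) (v1 ⬝ v0))))))
      (fun Δ s => ?_) ((((Env.nil.cons f).cons g).cons h).cons k)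
    have := RCAomega.qf_ind (b := b) (Γ := Δ)
      (.imp (.eq ((s _ (.s (.s (.s .z)))).wk ⬝ v0) ((s _ (.s (.s .z))).wk ⬝ v0))
        (.eq ((s _ (.s .z)).wk ⬝ v0) ((s _ .z).wk ⬝ v0))) (.imp (.eq _ _) (.eq _ _))
    refine .ax (hAx ?_)
    convert this using 1
    have hw : ∀ t : Tm Δ FT.one, (t.wk.rename ((Ren.shift .nat).lift .nat)).subst
        (Sub.one (suc v0)) = t.wk (ρ := .nat) := by
      intro t
      simp only [Tm.wk, Tm.rename, Tm.subst_subst]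
      rfl
    simp only [Tm.rename] at hw
    simp only [Fm.inst, Fm.rename, Fm.subst, Tm.subst, Tm.wk_subst_one, hw]
    rfl
  · have : (Env.nil : Env (M.quot hE).C []) = Env.nil.map (M.proj hE) := by
      funext σ v
      cases v
    rw [this, Str.sat_quot hE hS]
    exact hM₀

@[simp] theorem Env.cons_z {C : Ty → Type} {Γ : Ctx} {ρ : Ty} (x : C ρ) (e : Env C Γ) :
    e.cons x ρ .z = x := rfl

@[simp] theorem Env.cons_s {C : Ty → Type} {Γ : Ctx} {ρ σ : Ty} (x : C ρ) (e : Env C Γ)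
    (v : Var Γ σ) : e.cons x σ (.s v) = e σ v := rfl

attribute [simp] Str.eval_wk

/-! ### Combinatory abstraction and definable functions -/

namespace Model

/-- Elements of functional types are applied like functions. -/
instance (M : Model) {σ τ : Ty} : CoeFun (M.C (σ ⇒ τ)) fun _ => M.C σ → M.C τ := ⟨M.app⟩

variable (M : Model)

/-- The value of a term without the innermost variable does not depend on it. -/
theorem eval_drop {Γ : Ctx} {ρ σ : Ty} (t : Tm (ρ :: Γ) σ) {t' : Tm Γ σ} (h : t.drop = some t')
    (e : Env M.C Γ) (x : M.C ρ) : M.eval (e.cons x) t = M.eval e t' := by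
  induction t with
  | var v =>
    cases v with
    | z => simp [Tm.drop, Tm.dropVar] at h
    | s v => obtain rfl := Option.some.inj h; rfl
  | cst c => obtain rfl := Option.some.inj h; rfl
  | app a b iha ihb =>
    simp only [Tm.drop, Option.bind_eq_some_iff, Option.map_eq_some_iff] at h
    obtain ⟨a', ha, b', hb, rfl⟩ := h
    rw [Str.eval_app, Str.eval_app, iha ha, ihb hb]

@[simp] theorem eval_lam {Γ : Ctx} {ρ σ : Ty} (t : Tm (ρ :: Γ) σ) (e : Env M.C Γ) (x : M.C ρ) :
    M.app (M.eval e t.lam) x = M.eval (e.cons x) t := by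
  induction t with
  | var v =>
    cases v with
    | z =>
      simp only [Tm.lam, Tm.lamVar, Str.eval_app, Str.eval_cst, M.app_S, M.app_K]; rfl
    | s v => simp only [Tm.lam, Tm.lamVar, Str.eval_app, Str.eval_cst, M.app_K]; rfl
  | cst c => simp only [Tm.lam, Str.eval_app, Str.eval_cst, M.app_K]
  | app a b iha ihb =>
    rw [Tm.lam]
    cases h : Tm.drop (a ⬝ b) with
    | none => simp only [Option.elim, Str.eval_app, Str.eval_cst, M.app_S, iha, ihb]
    | some t =>
      rw [eval_drop M _ h]
      simp only [Option.elim, Str.eval_app, Str.eval_cst, M.app_K]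

end Model

/-! ### Abstraction commutes with substitution -/

namespace Tm

theorem drop_wk {Γ : Ctx} {ρ σ : Ty} (t : Tm Γ σ) : (t.wk (ρ := ρ)).drop = some t := by
  induction t with
  | var v => rfl
  | cst c => rfl
  | app a b iha ihb =>
    show Option.bind (drop a.wk) (fun a' => (drop b.wk).map fun b' => a' ⬝ b') = _
    rw [iha, ihb]; rfl

theorem drop_subst {Γ Δ : Ctx} {ρ σ : Ty} (t : Tm (ρ :: Γ) σ) (f : Sub Γ Δ) :
    (t.subst (f.lift ρ)).drop = t.drop.map (subst f) := by
  induction t with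
  | var v =>
    cases v with
    | z => rfl
    | s v => exact drop_wk _
  | cst c => rfl
  | app a b iha ihb =>
    simp only [subst, drop, iha, ihb]
    cases a.drop <;> cases b.drop <;> rfl

theorem lam_wk {Γ : Ctx} {ρ σ : Ty} (t : Tm Γ σ) :
    (t.wk (ρ := ρ)).lam = .cst (.K σ ρ) ⬝ t := by
  cases t with
  | var v => rfl
  | cst c => rfl
  | app a b =>
    show (drop ((a ⬝ b).wk)).elim _ _ = _
    rw [drop_wk]; rfl

@[simp] theorem lam_subst {Γ Δ : Ctx} {ρ σ : Ty} (t : Tm (ρ :: Γ) σ) (f : Sub Γ Δ) :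
    t.lam.subst f = (t.subst (f.lift ρ)).lam := by
  induction t with
  | var v =>
    cases v with
    | z => rfl
    | s v => exact (lam_wk _).symm
  | cst c => rfl
  | app a b iha ihb =>
    show _ = (drop ((a ⬝ b).subst (f.lift ρ))).elim _ _
    rw [drop_subst, lam]
    cases (a ⬝ b).drop with
    | none =>
      show _ ⬝ _ ⬝ _ = _
      rw [iha, ihb]; rfl
    | some t => rfl

attribute [simp] Tm.subst

@[simp] theorem _root_.FT.Sub.lift_z {Γ Δ : Ctx} (f : Sub Γ Δ) (ρ : Ty) :
    f.lift ρ ρ .z = .var .z := rfl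

@[simp] theorem _root_.FT.Sub.lift_s {Γ Δ : Ctx} (f : Sub Γ Δ) (ρ : Ty) {σ : Ty} (v : Var Γ σ) :
    f.lift ρ σ (.s v) = (f σ v).wk := rfl

@[simp] theorem wk_var {Γ : Ctx} {ρ σ : Ty} (v : Var Γ σ) :
    (Tm.var v).wk (ρ := ρ) = .var (.s v) := rfl

section

variable {Γ Δ : Ctx} (f : Sub Γ Δ)

@[simp] theorem add_subst : add.subst f = add := by simp [add]
@[simp] theorem mul_subst : mul.subst f = mul := by simp [mul]
@[simp] theorem pred_subst : pred.subst f = pred := by simp [pred]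
@[simp] theorem monus_subst : monus.subst f = monus := by simp [monus]
@[simp] theorem pow2_subst : pow2.subst f = pow2 := by simp [pow2]
@[simp] theorem parity_subst : parity.subst f = parity := by simp [parity]
@[simp] theorem half_subst : half.subst f = half := by simp [half]
@[simp] theorem dig_subst : dig.subst f = dig := by simp [dig]
@[simp] theorem tri_subst : tri.subst f = tri := by simp [tri]
@[simp] theorem pair_subst : pair.subst f = pair := by simp [pair]
@[simp] theorem bar_subst : bar.subst f = bar := by simp [bar]
@[simp] theorem count_subst : count.subst f = count := by simp [count]

end

end Tm

namespace Model

variable (M : Model)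

/-- The value of a closed term. -/
def cl {σ : Ty} (t : Tm [] σ) : M.C σ := M.eval .nil t

@[simp] theorem eval_ofClosed {Γ : Ctx} (e : Env M.C Γ) {σ : Ty} (t : Tm [] σ) :
    M.eval e (Tm.ofClosed t) = M.cl t :=
  Str.eval_ofClosed M.toStr e t

/-- A term that results from a closed term by substitution, such as a closed term of another context,
has the value of this closed term. -/
theorem eval_eq_cl {Γ : Ctx} (e : Env M.C Γ) {σ : Ty} {t : Tm [] σ} {t' : Tm Γ σ}
    (h : ∀ f : Sub [] Γ, t.subst f = t') : M.eval e t' = M.cl t := by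
  have hn : (fun _ v => M.eval e ((nofun : Sub [] Γ) _ v)) = (Env.nil : Env M.C []) := by
    funext σ v
    cases v
  rw [← h nofun, Str.eval_subst, cl, hn]

open Tm

section

variable {Γ : Ctx} (e : Env M.C Γ)

@[simp] theorem eval_add : M.eval e add = M.cl add := M.eval_eq_cl e fun _ => by simp
@[simp] theorem eval_mul : M.eval e mul = M.cl mul := M.eval_eq_cl e fun _ => by simp
@[simp] theorem eval_pred : M.eval e pred = M.cl pred := M.eval_eq_cl e fun _ => by simp
@[simp] theorem eval_monus : M.eval e monus = M.cl monus := M.eval_eq_cl e fun _ => by simp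
@[simp] theorem eval_pow2 : M.eval e pow2 = M.cl pow2 := M.eval_eq_cl e fun _ => by simp
@[simp] theorem eval_parity : M.eval e parity = M.cl parity := M.eval_eq_cl e fun _ => by simp
@[simp] theorem eval_half : M.eval e half = M.cl half := M.eval_eq_cl e fun _ => by simp
@[simp] theorem eval_dig : M.eval e dig = M.cl dig := M.eval_eq_cl e fun _ => by simp
@[simp] theorem eval_tri : M.eval e tri = M.cl tri := M.eval_eq_cl e fun _ => by simp
@[simp] theorem eval_pair : M.eval e pair = M.cl pair := M.eval_eq_cl e fun _ => by simp
@[simp] theorem eval_bar : M.eval e bar = M.cl bar := M.eval_eq_cl e fun _ => by simp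
@[simp] theorem eval_count : M.eval e count = M.cl count := M.eval_eq_cl e fun _ => by simp

end

end Model

namespace Model

open Tm

variable {M : Model}

/-! ### Arithmetic in a model -/

/-- The numbers of a model. -/
abbrev N (M : Model) : Type := M.C .nat

/-- A function between carriers that is given by an element of the model. -/
@[fun_prop]
def Rep {σ τ : Ty} (F : M.C σ → M.C τ) : Prop := ∃ f : M.C (σ ⇒ τ), ∀ x, f x = F x

@[fun_prop]
theorem Rep.const {σ τ : Ty} (c : M.C τ) : Rep fun _ : M.C σ => c :=
  ⟨M.cst (.K τ σ) c, M.app_K c⟩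

@[fun_prop]
theorem Rep.id {σ : Ty} : Rep fun x : M.C σ => x :=
  ⟨M.eval .nil (lam v0), M.eval_lam _ _⟩

@[fun_prop]
theorem Rep.app {ρ σ τ : Ty} {F : M.C ρ → M.C (σ ⇒ τ)} {G : M.C ρ → M.C σ} (hF : Rep F)
    (hG : Rep G) : Rep fun x => F x (G x) := by
  obtain ⟨f, hf⟩ := hF
  obtain ⟨g, hg⟩ := hG
  exact ⟨M.cst (.S ρ σ τ) f g, fun x => by rw [M.app_S, hf, hg]⟩

instance : Zero M.N := ⟨M.cst .zero⟩
instance : One M.N := ⟨M.app (M.cst .succ) 0⟩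
instance : Add M.N := ⟨fun x y => M.cl add x y⟩
instance : Mul M.N := ⟨fun x y => M.cl mul x y⟩
instance : _root_.Sub M.N := ⟨fun x y => M.cl monus x y⟩

theorem zero_def : M.cst .zero = (0 : M.N) := rfl
theorem add_def (x y : M.N) : M.cl add x y = x + y := rfl
theorem mul_def (x y : M.N) : M.cl mul x y = x * y := rfl
theorem monus_def (x y : M.N) : M.cl monus x y = x - y := rfl

@[fun_prop]
theorem Rep.add {σ : Ty} {F G : M.C σ → M.N} (hF : Rep F) (hG : Rep G) :
    Rep fun x => F x + G x := by
  simp only [← add_def]; fun_prop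

@[fun_prop]
theorem Rep.mul {σ : Ty} {F G : M.C σ → M.N} (hF : Rep F) (hG : Rep G) :
    Rep fun x => F x * G x := by
  simp only [← mul_def]; fun_prop

@[fun_prop]
theorem Rep.sub {σ : Ty} {F G : M.C σ → M.N} (hF : Rep F) (hG : Rep G) :
    Rep fun x => F x - G x := by
  simp only [← monus_def]; fun_prop

/-- Terms of different contexts for a step function give the same recursion. -/
theorem rec_congr {x y : M.N} {z z' : M.C (.nat ⇒ .nat ⇒ .nat)} (h : ∀ r i, z r i = z' r i) :
    M.cst .R x y z = M.cst .R x y z' := by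
  rw [M.app_ext z z' fun r => M.app_ext _ _ (h r)]

protected theorem add_zero (x : M.N) : x + 0 = x := by
  rw [← add_def, cl, Tm.add]
  simp [← zero_def, M.rec_zero]

theorem add_succ (x y : M.N) : x + M.app (M.cst .succ) y = M.app (M.cst .succ) (x + y) := by
  simp only [← add_def, cl, Tm.add]
  simp only [eval_lam, Str.eval_app, Str.eval_cst, Str.eval_var, Env.cons_z, Env.cons_s, M.rec_succ]
  exact congrArg _ (rec_congr fun r i => by simp)

theorem succ_def (x : M.N) : M.app (M.cst .succ) x = x + 1 := by
  show _ = x + M.app (M.cst .succ) 0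
  rw [add_succ, Model.add_zero]

/-- Quantifier-free induction for implications between equations of functions of the model. -/
theorem imp_induction {F G H K : M.N → M.N} (hF : Rep F) (hG : Rep G) (hH : Rep H) (hK : Rep K)
    (h0 : F 0 = G 0 → H 0 = K 0)
    (hs : ∀ n, (F n = G n → H n = K n) → F (n + 1) = G (n + 1) → H (n + 1) = K (n + 1)) (n : M.N) :
    F n = G n → H n = K n := by
  obtain ⟨f, hf⟩ := hF
  obtain ⟨g, hg⟩ := hG
  obtain ⟨h, hh⟩ := hH
  obtain ⟨k, hk⟩ := hK
  simp only [← hf, ← hg, ← hh, ← hk, ← succ_def] at *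
  exact M.imp_ind f g h k h0 hs n

theorem eq_induction {F G : M.N → M.N} (hF : Rep F) (hG : Rep G)
    (h0 : F 0 = G 0) (hs : ∀ n, F n = G n → F (n + 1) = G (n + 1)) (n : M.N) : F n = G n :=
  imp_induction (F := fun _ => 0) (G := fun _ => 0) (by fun_prop) (by fun_prop) hF hG
    (fun _ => h0) (fun n h _ => hs n (h rfl)) n rfl

theorem add_one_ne_zero (x : M.N) : x + 1 ≠ 0 := by
  rw [← succ_def]; exact M.succ_ne_zero x

theorem add_one_inj {x y : M.N} : x + 1 = y + 1 ↔ x = y :=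
  ⟨fun h => M.succ_inj x y (by rwa [succ_def, succ_def]), fun h => by rw [h]⟩

theorem add_add_one (x y : M.N) : x + (y + 1) = x + y + 1 := by
  rw [← succ_def, add_succ, succ_def]

protected theorem zero_add (x : M.N) : 0 + x = x :=
  eq_induction (F := fun x => 0 + x) (G := fun x => x) (by fun_prop) (by fun_prop)
    (Model.add_zero 0) (fun n h => by simp only [add_add_one, h]) x

protected theorem add_assoc (x y z : M.N) : x + y + z = x + (y + z) :=
  eq_induction (F := fun z => x + y + z) (G := fun z => x + (y + z)) (by fun_prop) (by fun_prop)
    (by simp only [Model.add_zero]) (fun n h => by simp only [add_add_one, h]) z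

theorem one_add (x : M.N) : 1 + x = x + 1 :=
  eq_induction (F := fun x => 1 + x) (G := fun x => x + 1) (by fun_prop) (by fun_prop)
    (by simp only [Model.add_zero, Model.zero_add])
    (fun n h => by simp only [add_add_one, h]) x

protected theorem add_comm (x y : M.N) : x + y = y + x :=
  eq_induction (F := fun y => x + y) (G := fun y => y + x) (by fun_prop) (by fun_prop)
    (by simp only [Model.add_zero, Model.zero_add])
    (fun n h => by
      rw [add_add_one, h, Model.add_assoc n 1 x, one_add, add_add_one]) y

protected theorem mul_zero (x : M.N) : x * 0 = 0 := by
  rw [← mul_def, cl, Tm.mul]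
  simp [← zero_def, M.rec_zero]

theorem mul_add_one (x y : M.N) : x * (y + 1) = x * y + x := by
  rw [← succ_def]
  simp only [← mul_def, cl, Tm.mul]
  simp only [eval_lam, Str.eval_app, Str.eval_cst, Str.eval_var, Env.cons_z, Env.cons_s, M.rec_succ,
    eval_add, add_def]
  exact congrArg (· + x) (rec_congr fun r i => by simp)

protected theorem mul_add (x y z : M.N) : x * (y + z) = x * y + x * z :=
  eq_induction (F := fun z => x * (y + z)) (G := fun z => x * y + x * z) (by fun_prop)
    (by fun_prop) (by simp only [Model.add_zero, Model.mul_zero])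
    (fun n h => by
      rw [add_add_one, mul_add_one, h, mul_add_one, Model.add_assoc]) z

protected theorem zero_mul (x : M.N) : 0 * x = 0 :=
  eq_induction (F := fun x => 0 * x) (G := fun _ => 0) (by fun_prop) (by fun_prop)
    (Model.mul_zero 0) (fun n h => by simp only [mul_add_one, h, Model.add_zero]) x

theorem add_one_mul (x y : M.N) : (x + 1) * y = x * y + y :=
  eq_induction (F := fun y => (x + 1) * y) (G := fun y => x * y + y) (by fun_prop) (by fun_prop)
    (by simp only [Model.mul_zero, Model.add_zero])
    (fun n h => by
      simp only [mul_add_one, h, add_add_one, add_one_inj]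
      rw [Model.add_assoc, Model.add_assoc, Model.add_comm n x]) y

protected theorem mul_comm (x y : M.N) : x * y = y * x :=
  eq_induction (F := fun y => x * y) (G := fun y => y * x) (by fun_prop) (by fun_prop)
    (by simp only [Model.mul_zero, Model.zero_mul])
    (fun n h => by simp only [mul_add_one, add_one_mul, h]) y

protected theorem mul_assoc (x y z : M.N) : x * y * z = x * (y * z) :=
  eq_induction (F := fun z => x * y * z) (G := fun z => x * (y * z)) (by fun_prop) (by fun_prop)
    (by simp only [Model.mul_zero]) (fun n h => by
      rw [mul_add_one, h, mul_add_one, Model.mul_add]) z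

protected theorem mul_one (x : M.N) : x * 1 = x := by
  rw [← Model.zero_add 1, mul_add_one, Model.mul_zero, Model.zero_add]

instance : CommSemiring M.N where
  add_assoc := Model.add_assoc
  zero_add := Model.zero_add
  add_zero := Model.add_zero
  add_comm := Model.add_comm
  mul_assoc := Model.mul_assoc
  one_mul x := by rw [Model.mul_comm, Model.mul_one]
  mul_one := Model.mul_one
  left_distrib := Model.mul_add
  right_distrib x y z := by
    rw [Model.mul_comm, Model.mul_add, Model.mul_comm z x, Model.mul_comm z y]
  zero_mul := Model.zero_mul
  mul_zero := Model.mul_zero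
  mul_comm := Model.mul_comm
  nsmul := nsmulRec

/-- Every number is zero or a successor. -/
theorem eq_zero_or_eq_add_one (x : M.N) : x = 0 ∨ ∃ y, x = y + 1 := by
  by_contra! h
  -- Otherwise `n ≠ x` can be proved by induction on `n`.
  have := imp_induction (F := fun n => n) (G := fun _ => x) (H := fun _ => 0 + 1)
    (K := fun _ => 0) (by fun_prop) (by fun_prop) (by fun_prop) (by fun_prop)
    (fun h' => absurd h'.symm h.1) (fun n _ h' => absurd h'.symm (h.2 n)) x rfl
  exact add_one_ne_zero 0 this

theorem pred_zero : M.cl pred 0 = 0 := by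
  rw [cl, Tm.pred]
  simp [← zero_def, M.rec_zero]

theorem pred_add_one (x : M.N) : M.cl pred (x + 1) = x := by
  rw [← succ_def, cl, Tm.pred]
  simp [M.rec_succ]

protected theorem sub_zero (x : M.N) : x - 0 = x := by
  rw [← monus_def, cl, Tm.monus]
  simp [← zero_def, M.rec_zero]

theorem sub_add_one (x y : M.N) : x - (y + 1) = M.cl pred (x - y) := by
  rw [← succ_def]
  simp only [← monus_def, cl, Tm.monus]
  simp only [eval_lam, Str.eval_app, Str.eval_cst, Str.eval_var, Env.cons_z, Env.cons_s, M.rec_succ,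
    eval_pred]
  exact congrArg (M.cl pred) (rec_congr fun r i => by simp)

theorem add_one_sub_add_one (x y : M.N) : x + 1 - (y + 1) = x - y :=
  eq_induction (F := fun y => x + 1 - (y + 1)) (G := fun y => x - y) (by fun_prop) (by fun_prop)
    (by simp only [sub_add_one, Model.sub_zero, pred_add_one])
    (fun n h => by rw [sub_add_one, h, sub_add_one]) y

theorem zero_sub' (x : M.N) : 0 - x = 0 :=
  eq_induction (F := fun x => 0 - x) (G := fun _ => 0) (by fun_prop) (by fun_prop)
    (Model.sub_zero 0) (fun n h => by simp only [sub_add_one, h, pred_zero]) x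

theorem add_sub_cancel_right' (x y : M.N) : x + y - y = x :=
  eq_induction (F := fun y => x + y - y) (G := fun _ => x) (by fun_prop) (by fun_prop)
    (by simp only [Model.sub_zero, Model.add_zero])
    (fun n h => by rw [← add_assoc, add_one_sub_add_one, h]) y

theorem sub_self' (x : M.N) : x - x = 0 := by
  have := add_sub_cancel_right' 0 x
  rwa [zero_add] at this

theorem one_sub_eq_zero_iff {x : M.N} : 1 - x = 0 ↔ x ≠ 0 := by
  have h1 : (1 : M.N) = 0 + 1 := (zero_add 1).symm
  rcases eq_zero_or_eq_add_one x with rfl | ⟨y, rfl⟩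
  · rw [Model.sub_zero, h1]
    exact iff_of_false (add_one_ne_zero 0) (not_not.2 rfl)
  · refine iff_of_true ?_ (add_one_ne_zero y)
    nth_rw 1 [h1]
    rw [add_one_sub_add_one, zero_sub']

/-- The order is introduced by truncated subtraction; this is one half of its totality. -/
theorem eq_add_sub_of_sub_ne_zero {x y : M.N} : x - y ≠ 0 → x = y + (x - y) := by
  rw [← one_sub_eq_zero_iff]
  refine imp_induction (F := fun y => 1 - (x - y)) (G := fun _ => 0) (H := fun _ => x)
    (K := fun y => y + (x - y)) (by fun_prop) (by fun_prop) (by fun_prop) (by fun_prop)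
    (fun _ => by simp only [Model.sub_zero, zero_add]) (fun n ih h => ?_) y
  simp only [one_sub_eq_zero_iff, sub_add_one] at ih h ⊢
  rcases eq_zero_or_eq_add_one (x - n) with h0 | ⟨z, hz⟩
  · exact absurd (by rw [h0, pred_zero]) h
  · rw [hz, pred_add_one]
    conv_lhs => rw [ih (by rw [hz]; exact add_one_ne_zero z), hz]
    ring

theorem eq_add_sub_of_sub_eq_zero {x y : M.N} : x - y = 0 → y = x + (y - x) := by
  refine imp_induction (F := fun y => x - y) (G := fun _ => 0) (H := fun y => y)
    (K := fun y => x + (y - x)) (by fun_prop) (by fun_prop) (by fun_prop) (by fun_prop)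
    (fun h => ?_) (fun n ih h => ?_) y
  · simp only [Model.sub_zero] at h
    rw [h, Model.sub_zero, zero_add]
  · rcases eq_zero_or_eq_add_one (x - n) with h0 | ⟨z, hz⟩
    · obtain ⟨w, hw⟩ : ∃ w, n = x + w := ⟨_, ih h0⟩
      rw [hw, show x + w + 1 = (w + 1) + x by ring, add_sub_cancel_right']
      ring
    · have h₁ := eq_add_sub_of_sub_ne_zero (x := x) (y := n) (by rw [hz]; exact add_one_ne_zero z)
      simp only [sub_add_one, hz, pred_add_one] at h h₁
      rw [h, zero_add] at h₁
      rw [h₁, sub_self', add_zero]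

theorem exists_add_of_sub_eq_zero {x y : M.N} : x - y = 0 ↔ ∃ z, y = x + z := by
  refine ⟨fun h => ⟨_, eq_add_sub_of_sub_eq_zero h⟩, ?_⟩
  rintro ⟨z, rfl⟩
  refine eq_induction (F := fun x => x - (x + z)) (G := fun _ => 0) (by fun_prop) (by fun_prop)
    (zero_sub' _) (fun n h => ?_) x
  rw [show n + 1 + z = n + z + 1 by ring, add_one_sub_add_one, h]

theorem add_right_cancel' {x y z : M.N} (h : x + z = y + z) : x = y := by
  rw [← add_sub_cancel_right' x z, h, add_sub_cancel_right']

theorem eq_zero_of_add_eq_zero {x y : M.N} (h : x + y = 0) : x = 0 ∧ y = 0 := by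
  rcases eq_zero_or_eq_add_one y with rfl | ⟨z, rfl⟩
  · exact ⟨by rwa [add_zero] at h, rfl⟩
  · rw [← add_assoc] at h
    exact absurd h (add_one_ne_zero _)

open Classical in
/-- The order of the numbers, with `x ≤ y` as expressed by `Fm.le`. -/
noncomputable instance : LinearOrder M.N where
  le x y := x - y = 0
  le_refl := sub_self'
  le_trans x y z h₁ h₂ := by
    rw [exists_add_of_sub_eq_zero] at *
    obtain ⟨u, rfl⟩ := h₁
    obtain ⟨v, rfl⟩ := h₂
    exact ⟨u + v, add_assoc _ _ _⟩
  le_antisymm x y h₁ h₂ := by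
    rw [exists_add_of_sub_eq_zero] at *
    obtain ⟨u, rfl⟩ := h₁
    obtain ⟨v, h⟩ := h₂
    have : u + v = 0 := add_right_cancel' (z := x) (by rw [zero_add, ← add_comm x, ← add_assoc, ← h])
    rw [(eq_zero_of_add_eq_zero this).1, add_zero]
  le_total x y := by
    by_cases h : x - y = 0
    · exact .inl h
    · refine .inr (exists_add_of_sub_eq_zero.2 ⟨_, eq_add_sub_of_sub_ne_zero h⟩)
  toDecidableLE := Classical.decRel _

theorem le_def {x y : M.N} : x ≤ y ↔ x - y = 0 := Iff.rfl

theorem le_iff_exists_add' {x y : M.N} : x ≤ y ↔ ∃ z, y = x + z := exists_add_of_sub_eq_zero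

instance : CanonicallyOrderedAdd M.N where
  le_self_add _ y := le_iff_exists_add'.2 ⟨y, rfl⟩
  le_add_self _ y := le_iff_exists_add'.2 ⟨y, add_comm _ _⟩
  exists_add_of_le h := le_iff_exists_add'.1 h

instance : IsOrderedCancelAddMonoid M.N where
  add_le_add_left x y h z := by
    obtain ⟨u, rfl⟩ := le_iff_exists_add'.1 h
    exact le_iff_exists_add'.2 ⟨u, by ring⟩
  le_of_add_le_add_left x y z h := by
    obtain ⟨u, hu⟩ := le_iff_exists_add'.1 h
    exact le_iff_exists_add'.2 ⟨u, add_right_cancel' (z := x) (by rw [add_comm z, hu]; ring)⟩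

instance : NoZeroDivisors M.N where
  eq_zero_or_eq_zero_of_mul_eq_zero {x y} h := by
    rcases eq_zero_or_eq_add_one y with rfl | ⟨z, rfl⟩
    · exact .inr rfl
    · rw [mul_add, mul_one] at h
      exact .inl (eq_zero_of_add_eq_zero h).2

instance : Nontrivial M.N := ⟨0, 0 + 1, (add_one_ne_zero 0).symm⟩

theorem mul_lt_mul_aux {a b c : M.N} (hc : 0 < c) (h : a < b) : a * c < b * c := by
  obtain ⟨u, rfl⟩ := le_iff_exists_add'.1 h.le
  rw [add_mul]
  refine lt_add_of_pos_right _ (pos_iff_ne_zero.2 (mul_ne_zero ?_ hc.ne'))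
  rintro rfl
  exact absurd h (by rw [add_zero]; exact lt_irrefl a)

instance : IsStrictOrderedRing M.N where
  zero_le_one := zero_le
  mul_lt_mul_of_pos_left a ha b c h := by
    simp only [mul_comm a]
    exact mul_lt_mul_aux ha h
  mul_lt_mul_of_pos_right a ha b c h := mul_lt_mul_aux ha h

instance : OrderedSub M.N where
  tsub_le_iff_right x y z := by
    by_cases h : x - y = 0
    · rw [h]
      have : x ≤ y := h
      exact ⟨fun _ => this.trans le_add_self, fun _ => zero_le⟩
    · conv_rhs => rw [eq_add_sub_of_sub_ne_zero h, add_comm, add_le_add_iff_right]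

theorem lt_add_one_iff' {x y : M.N} : x < y + 1 ↔ x ≤ y := by
  refine ⟨fun h => ?_, fun h => lt_of_le_of_lt h (lt_add_of_pos_right y zero_lt_one)⟩
  obtain ⟨z, hz⟩ := le_iff_exists_add'.1 h.le
  rcases eq_zero_or_eq_add_one z with rfl | ⟨w, rfl⟩
  · exact absurd h (by rw [hz, add_zero]; exact lt_irrefl _)
  · rw [← add_assoc, add_one_inj] at hz
    exact le_iff_exists_add'.2 ⟨w, hz⟩

theorem add_one_le_iff' {x y : M.N} : x + 1 ≤ y ↔ x < y := by
  rw [← not_lt, lt_add_one_iff', not_le]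

noncomputable instance : SuccOrder M.N := .ofSuccLeIff (· + 1) add_one_le_iff'

noncomputable instance : SuccAddOrder M.N := ⟨fun _ => rfl⟩

/-! ### Decidable predicates and induction -/

/-- A predicate on the numbers of a model whose characteristic function belongs to the model. -/
@[fun_prop]
def Dec (P : M.N → Prop) : Prop := ∃ F : M.N → M.N, Rep F ∧ ∀ n, P n ↔ F n = 0

@[fun_prop]
theorem Dec.eq {F G : M.N → M.N} (hF : Rep F) (hG : Rep G) : Dec fun n => F n = G n := by
  refine ⟨fun n => F n - G n + (G n - F n), by fun_prop, fun n => ?_⟩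
  show F n = G n ↔ F n - G n + (G n - F n) = 0
  rw [add_eq_zero, tsub_eq_zero_iff_le, tsub_eq_zero_iff_le, le_antisymm_iff]

@[fun_prop]
theorem Dec.le {F G : M.N → M.N} (hF : Rep F) (hG : Rep G) : Dec fun n => F n ≤ G n :=
  ⟨fun n => F n - G n, by fun_prop, fun _ => le_def⟩

@[fun_prop]
theorem Dec.lt {F G : M.N → M.N} (hF : Rep F) (hG : Rep G) : Dec fun n => F n < G n := by
  have h : (fun n => F n < G n) = fun n => F n + 1 ≤ G n := by
    funext n
    rw [Order.add_one_le_iff]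
  rw [h]
  fun_prop

@[fun_prop]
theorem Dec.not {P : M.N → Prop} (hP : Dec P) : Dec fun n => ¬ P n := by
  obtain ⟨F, hF, h⟩ := hP
  exact ⟨fun n => 1 - F n, by fun_prop, fun n => (h n).not.trans one_sub_eq_zero_iff.symm⟩

@[fun_prop]
theorem Dec.or {P Q : M.N → Prop} (hP : Dec P) (hQ : Dec Q) : Dec fun n => P n ∨ Q n := by
  obtain ⟨F, hF, h⟩ := hP
  obtain ⟨G, hG, h'⟩ := hQ
  exact ⟨fun n => F n * G n, by fun_prop, fun n => (or_congr (h n) (h' n)).trans mul_eq_zero.symm⟩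

theorem Dec.imp {P Q : M.N → Prop} (hP : Dec P) (hQ : Dec Q) : Dec fun n => P n → Q n := by
  simp only [imp_iff_not_or]
  fun_prop

/-- Induction for predicates with characteristic functions in the model. -/
theorem induction {P : M.N → Prop} (hP : Dec P) (h0 : P 0) (hs : ∀ n, P n → P (n + 1)) (n : M.N) :
    P n := by
  obtain ⟨F, hF, h⟩ := hP
  rw [h]
  have := imp_induction (F := fun _ => 0) (G := fun _ => 0) (by fun_prop) (by fun_prop) hF
    (Rep.const 0) (fun _ => (h 0).1 h0) (fun n ih _ => (h _).1 (hs n ((h n).2 (ih rfl)))) n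
  exact this rfl

/-! ### Primitive recursive functions -/

@[simp] theorem pow2_zero : M.cl pow2 0 = (1 : M.N) := by
  rw [cl, pow2]
  simp only [eval_lam, Str.eval_app, Str.eval_cst, Str.eval_var, Env.cons_z, ← zero_def,
    M.rec_zero]
  rfl

theorem pow2_add_one (n : M.N) : M.cl pow2 (n + 1) = (M.cl pow2 n + M.cl pow2 n : M.N) := by
  rw [← succ_def, cl, pow2]
  simp only [eval_lam, Str.eval_app, Str.eval_cst, Str.eval_var, Env.cons_z, Env.cons_s,
    M.rec_succ, eval_add, add_def]
  exact congrArg (fun x : M.N => x + x) (rec_congr fun r i => by simp)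

@[simp] theorem parity_zero : M.cl parity 0 = (0 : M.N) := by
  rw [cl, parity]
  simp [← zero_def, M.rec_zero]

theorem parity_add_one (n : M.N) : M.cl parity (n + 1) = 1 - (M.cl parity n : M.N) := by
  rw [← succ_def, cl, parity]
  simp only [eval_lam, Str.eval_app, Str.eval_cst, Str.eval_var, Env.cons_z, Env.cons_s,
    M.rec_succ, eval_monus, monus_def]
  exact congrArg (fun x : M.N => 1 - x) (rec_congr fun r i => by simp)

@[simp] theorem half_zero : M.cl half 0 = (0 : M.N) := by
  rw [cl, half]
  simp [← zero_def, M.rec_zero]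

theorem half_add_one (n : M.N) : M.cl half (n + 1) = (M.cl half n + M.cl parity n : M.N) := by
  rw [← succ_def, cl, half]
  simp only [eval_lam, Str.eval_app, Str.eval_cst, Str.eval_var, Env.cons_z, Env.cons_s,
    M.rec_succ, eval_add, add_def, eval_parity]
  exact congrArg (fun x : M.N => x + M.cl parity n) (rec_congr fun r i => by simp)

@[simp] theorem tri_zero : M.cl tri 0 = (0 : M.N) := by
  rw [cl, tri]
  simp [← zero_def, M.rec_zero]

theorem tri_add_one (n : M.N) : M.cl tri (n + 1) = (M.cl tri n + (n + 1) : M.N) := by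
  rw [← succ_def, cl, tri]
  simp only [eval_lam, Str.eval_app, Str.eval_cst, Str.eval_var, Env.cons_z, Env.cons_s,
    M.rec_succ, eval_add, add_def]
  rw [succ_def]
  exact congrArg (fun x : M.N => x + (n + 1)) (rec_congr fun r i => by simp)

theorem pair_def (a b : M.N) : M.cl pair a b = (M.cl tri (a + b) + b : M.N) := by
  rw [cl, pair]
  simp [add_def]

@[simp] theorem bar_zero (f : M.C one) : M.cl bar f 0 = (0 : M.N) := by
  rw [cl, bar]
  simp [← zero_def, M.rec_zero]

theorem bar_add_one (f : M.C one) (n : M.N) :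
    M.cl bar f (n + 1) = (M.cl pair (M.cl bar f n) (f n) + 1 : M.N) := by
  rw [← succ_def, cl, bar]
  simp only [eval_lam, Str.eval_app, Str.eval_cst, Str.eval_var, Env.cons_z, Env.cons_s,
    M.rec_succ, eval_pair]
  rw [succ_def]
  exact congrArg (fun x : M.N => M.cl pair x (f n) + 1) (rec_congr fun r i => by simp)

/-- `i` shifted to the right by `k` binary digits. -/
def shr : Tm [] (Ty.nat ⇒ one) := lam (lam (rc v0 v1 (lam (lam (half ⬝ v1)))))

@[simp] theorem shr_zero (i : M.N) : M.cl shr i 0 = i := by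
  rw [cl, shr]
  simp [← zero_def, M.rec_zero]

theorem shr_add_one (i k : M.N) : M.cl shr i (k + 1) = M.cl half (M.cl shr i k) := by
  rw [← succ_def, cl, shr]
  simp only [eval_lam, Str.eval_app, Str.eval_cst, Str.eval_var, Env.cons_z, Env.cons_s,
    M.rec_succ, eval_half]
  exact congrArg (M.cl half) (rec_congr fun r i => by simp)

theorem dig_def (i k : M.N) : M.cl dig i k = M.cl parity (M.cl shr i k) := by
  rw [cl, dig, cl, cl, shr]
  simp only [eval_lam, Str.eval_app, Str.eval_cst, Str.eval_var, Env.cons_z, Env.cons_s,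
    eval_parity]

theorem dig_zero (i : M.N) : M.cl dig i 0 = M.cl parity i := by
  rw [dig_def, shr_zero]

/-- The sum of the first `b` values of a function `f`, as `sum f b`. -/
def sum : Tm [] (one ⇒ one) := lam (lam (rc v0 zero (lam (lam (add ⬝ v1 ⬝ (v3 ⬝ v0))))))

@[simp] theorem sum_zero (f : M.C one) : M.cl sum f 0 = (0 : M.N) := by
  rw [cl, sum]
  simp [← zero_def, M.rec_zero]

theorem sum_add_one (f : M.C one) (b : M.N) : M.cl sum f (b + 1) = (M.cl sum f b + f b : M.N) := by
  rw [← succ_def, cl, sum]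
  simp only [eval_lam, Str.eval_app, Str.eval_cst, Str.eval_var, Env.cons_z, Env.cons_s,
    M.rec_succ, eval_add, add_def]
  exact congrArg (· + (f b : M.N)) (rec_congr fun r i => by simp)

theorem count_def (T : M.C one) (n : M.N) : M.cl count T n =
    M.cl sum (M.eval ((Env.nil.cons T).cons n) (lam (v2 ⬝ (bar ⬝ (dig ⬝ v0) ⬝ v1))))
      (M.cl pow2 n) := by
  rw [cl, count, cl, sum]
  simp only [eval_lam, Str.eval_app, Str.eval_cst, Str.eval_var, Env.cons_z, eval_pow2]
  exact rec_congr fun r i => by simp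

/-! ### Digits and codes -/

theorem parity_le_one (n : M.N) : M.cl parity n ≤ (1 : M.N) := by
  rcases eq_zero_or_eq_add_one n with rfl | ⟨m, rfl⟩
  · simp
  · rw [parity_add_one]
    exact tsub_le_self

theorem eq_zero_or_eq_one {x : M.N} (h : x ≤ 1) : x = 0 ∨ x = 1 := by
  rcases eq_zero_or_eq_add_one x with rfl | ⟨y, rfl⟩
  · exact .inl rfl
  · right
    rw [add_le_iff_nonpos_left, nonpos_iff_eq_zero] at h
    rw [h, zero_add]

theorem half_add_half (n : M.N) : M.cl half n + M.cl half n + M.cl parity n = n := by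
  refine eq_induction (F := fun n => M.cl half n + M.cl half n + M.cl parity n)
    (G := fun n => n) (by fun_prop) (by fun_prop) (by simp) (fun n h => ?_) n
  rw [half_add_one, parity_add_one]
  conv_rhs => rw [← h]
  rcases eq_zero_or_eq_one (parity_le_one n) with h' | h' <;> rw [h']
  · simp
  · simp; ring

theorem parity_half_double (n : M.N) :
    M.cl parity (n + n) = (0 : M.N) ∧ M.cl half (n + n) = n := by
  have h₁ : M.cl parity (n + n) = (0 : M.N) := by
    refine eq_induction (F := fun n => M.cl parity (n + n)) (G := fun n => 0) (by fun_prop)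
      (by fun_prop) (by simp) (fun n h => ?_) n
    rw [show n + 1 + (n + 1) = n + n + 1 + 1 by ring, parity_add_one, parity_add_one, h]
    simp
  refine ⟨h₁, ?_⟩
  have h₂ := half_add_half (n + n)
  rw [h₁, add_zero] at h₂
  rcases lt_trichotomy (M.cl half (n + n)) n with h | h | h
  · exact absurd h₂ (add_lt_add h h).ne
  · exact h
  · exact absurd h₂ (add_lt_add h h).ne'

theorem half_double_add (n a : M.N) (ha : a ≤ 1) : M.cl half (n + n + a) = n := by
  rcases eq_zero_or_eq_one ha with rfl | rfl
  · rw [add_zero, (parity_half_double n).2]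
  · rw [half_add_one, (parity_half_double n).1, (parity_half_double n).2, add_zero]

theorem parity_double_add (n a : M.N) (ha : a ≤ 1) : M.cl parity (n + n + a) = a := by
  rcases eq_zero_or_eq_one ha with rfl | rfl
  · rw [add_zero, (parity_half_double n).1]
  · rw [parity_add_one, (parity_half_double n).1]; simp

theorem pow2_pos (n : M.N) : 0 < (M.cl pow2 n : M.N) := by
  refine induction (P := fun n => 0 < (M.cl pow2 n : M.N)) (by fun_prop) (by simp)
    (fun n h => ?_) n
  rw [pow2_add_one]
  exact add_pos h h

theorem tri_mono {m n : M.N} (h : m ≤ n) : (M.cl tri m : M.N) ≤ M.cl tri n := by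
  obtain ⟨k, rfl⟩ := le_iff_exists_add'.1 h
  refine induction (P := fun k => (M.cl tri m : M.N) ≤ M.cl tri (m + k)) (by fun_prop) (by simp)
    (fun k h => ?_) k
  rw [← add_assoc, tri_add_one]
  exact h.trans le_self_add

theorem pair_lt_of_add_lt {a b a' b' : M.N} (h : a + b < a' + b') :
    (M.cl pair a b : M.N) < M.cl pair a' b' := by
  rw [pair_def, pair_def]
  calc (M.cl tri (a + b) + b : M.N) < M.cl tri (a + b) + (a + b + 1) := by
        rw [add_lt_add_iff_left, Order.lt_add_one_iff]; exact le_add_self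
    _ = M.cl tri (a + b + 1) := (tri_add_one _).symm
    _ ≤ M.cl tri (a' + b') := tri_mono (Order.add_one_le_iff.2 h)
    _ ≤ _ := le_self_add

theorem pair_inj {a b a' b' : M.N} (h : M.cl pair a b = M.cl pair a' b') : a = a' ∧ b = b' := by
  rcases lt_trichotomy (a + b) (a' + b') with h' | h' | h'
  · exact absurd h (pair_lt_of_add_lt h').ne
  · rw [pair_def, pair_def, h', add_right_inj] at h
    subst h
    exact ⟨add_right_cancel h', rfl⟩
  · exact absurd h (pair_lt_of_add_lt h').ne'

theorem le_tri (n : M.N) : n ≤ M.cl tri n := by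
  rcases eq_zero_or_eq_add_one n with rfl | ⟨m, rfl⟩
  · simp
  · rw [tri_add_one]
    exact le_add_self

theorem le_pair (a b : M.N) : a ≤ M.cl pair a b := by
  rw [pair_def]
  exact le_self_add.trans ((le_tri _).trans le_self_add)

/-- A code is at least as large as the length of the coded sequence. -/
theorem le_bar (f : M.C one) (n : M.N) : n ≤ M.cl bar f n := by
  refine induction (P := fun n => n ≤ M.cl bar f n) (by fun_prop) (by simp) (fun n h => ?_) n
  rw [bar_add_one]
  exact add_le_add_left (h.trans (le_pair _ _)) 1

theorem bar_congr {f g : M.C one} {n : M.N} (h : ∀ k < n, f k = g k) :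
    M.cl bar f n = M.cl bar g n := by
  refine induction (P := fun k => k ≤ n → M.cl bar f k = M.cl bar g k)
    (Dec.imp (by fun_prop) (by fun_prop)) (fun _ => by simp) (fun k ih hk => ?_) n le_rfl
  rw [Order.add_one_le_iff] at hk
  rw [bar_add_one, bar_add_one, ih hk.le, h k hk]

theorem bar_add_one_inj {f g : M.C one} {m n : M.N}
    (h : M.cl bar f (m + 1) = M.cl bar g (n + 1)) :
    M.cl bar f m = M.cl bar g n ∧ f m = g n := by
  rw [bar_add_one, bar_add_one, add_one_inj] at h
  exact pair_inj h

theorem eq_zero_of_bar {f : M.C one} {n : M.N} (h : M.cl bar f n = (0 : M.N)) : n = 0 := by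
  have := le_bar f n
  rwa [h, nonpos_iff_eq_zero] at this

/-- Codes of shortened sequences; the last `t` entries are removed. -/
theorem bar_sub {f g : M.C one} {m n : M.N} (h : M.cl bar f m = M.cl bar g n) (t : M.N) :
    M.cl bar f (m - t) = M.cl bar g (n - t) := by
  refine eq_induction (F := fun t => M.cl bar f (m - t)) (G := fun t => M.cl bar g (n - t))
    (by fun_prop) (by fun_prop) (by simpa using h) (fun t ih => ?_) t
  rw [← tsub_tsub, ← tsub_tsub]
  rcases eq_zero_or_eq_add_one (m - t) with h₁ | ⟨a, h₁⟩
  · rw [h₁] at ih ⊢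
    rw [bar_zero] at ih
    rw [eq_zero_of_bar ih.symm]; simp
  · rcases eq_zero_or_eq_add_one (n - t) with h₂ | ⟨b, h₂⟩
    · rw [h₂, bar_zero] at ih
      rw [eq_zero_of_bar ih, h₂]; simp
    · rw [h₁, h₂] at ih ⊢
      rw [add_tsub_cancel_right, add_tsub_cancel_right]
      exact (bar_add_one_inj ih).1

/-- A code determines the length and the entries of the sequence. -/
theorem bar_inj {f g : M.C one} {m n : M.N} (h : M.cl bar f m = M.cl bar g n) :
    m = n ∧ ∀ k < m, f k = g k := by
  have key : ∀ {f g : M.C one} {m n : M.N}, M.cl bar f m = M.cl bar g n → n ≤ m := by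
    intro f g m n h
    have := bar_sub h m
    rw [tsub_self, bar_zero] at this
    exact tsub_eq_zero_iff_le.1 (eq_zero_of_bar this.symm)
  obtain rfl : m = n := le_antisymm (key h.symm) (key h)
  refine ⟨rfl, fun k hk => ?_⟩
  have := bar_sub h (m - (k + 1))
  rw [tsub_tsub_cancel_of_le (Order.add_one_le_iff.2 hk)] at this
  exact (bar_add_one_inj this).2

theorem bar_inj' {f g : M.C one} {n : M.N} (h : M.cl bar f n = M.cl bar g n) {k : M.N}
    (hk : k ≤ n) : M.cl bar f k = M.cl bar g k :=
  bar_congr fun i hi => (bar_inj h).2 i (hi.trans_le hk)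

theorem dig_le_one (i k : M.N) : M.cl dig i k ≤ (1 : M.N) := by
  rw [dig_def]; exact parity_le_one _

/-- Every finite 0-1-sequence of length `n` is the digit sequence of a number below `2 ^ n`. -/
theorem exists_dig_eq {α : M.C one} (hα : ∀ k, α k ≤ (1 : M.N)) (n : M.N) :
    ∃ i < (M.cl pow2 n : M.N), M.cl bar (M.cl dig i) n = M.cl bar α n := by
  -- The number is built from its leading digit: `e (t + 1) = 2 * e t + α (n - (t + 1))`.
  let e : M.C one := M.eval ((Env.nil.cons α).cons n)
    (lam (rc v0 zero (lam (lam (add ⬝ (add ⬝ v1 ⬝ v1) ⬝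
      (.var (.s (.s (.s (.s .z)))) ⬝ (monus ⬝ v3 ⬝ suc v0)))))))
  have e0 : e 0 = (0 : M.N) := by simp [e, ← zero_def, M.rec_zero]
  have es : ∀ t : M.N, e (t + 1) = (e t + e t + α (n - (t + 1)) : M.N) := by
    intro t
    rw [← succ_def]
    simp only [e, eval_lam, Str.eval_app, Str.eval_cst, Str.eval_var, Env.cons_z, Env.cons_s,
      M.rec_succ, eval_add, eval_monus, add_def, monus_def]
    rw [rec_congr]
    intro r i
    simp
  have elt : ∀ t, e t < (M.cl pow2 t : M.N) := by
    intro t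
    refine induction (P := fun t => e t < (M.cl pow2 t : M.N)) (by fun_prop) (by simp [e0])
      (fun t h => ?_) t
    rw [es, pow2_add_one, ← Order.add_one_le_iff]
    calc (e t + e t + α (n - (t + 1)) + 1 : M.N) ≤ e t + e t + 1 + 1 := by gcongr; exact hα _
      _ = (e t + 1) + (e t + 1) := by ring
      _ ≤ _ := add_le_add (Order.add_one_le_iff.2 h) (Order.add_one_le_iff.2 h)
  have ehalf : ∀ t : M.N, M.cl half (e t) = e (t - 1) := by
    intro t
    rcases eq_zero_or_eq_add_one t with rfl | ⟨s, rfl⟩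
    · simp [e0]
    · rw [es, half_double_add _ _ (hα _), add_tsub_cancel_right]
  have eshr : ∀ k : M.N, M.cl shr (e n) k = e (n - k) := by
    intro k
    refine eq_induction (F := fun k => M.cl shr (e n) k) (G := fun k => e (n - k)) (by fun_prop)
      (by fun_prop) (by simp) (fun k h => ?_) k
    rw [shr_add_one, h, ehalf, tsub_tsub]
  refine ⟨e n, elt n, bar_congr fun k hk => ?_⟩
  have h₁ : n - k = n - (k + 1) + 1 := by
    rw [← tsub_tsub, tsub_add_cancel_of_le]
    rw [← zero_add (1 : M.N), Order.add_one_le_iff]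
    exact tsub_pos_of_lt hk
  rw [dig_def, eshr, h₁, es, parity_double_add _ _ (hα _), ← h₁, tsub_tsub_cancel_of_le hk.le]

/-- `exists_dig_eq` for functions whose further values need not be `0` or `1`. -/
theorem exists_dig_eq_of_lt {α : M.C one} {n : M.N} (hα : ∀ k < n, α k ≤ (1 : M.N)) :
    ∃ i < (M.cl pow2 n : M.N), M.cl bar (M.cl dig i) n = M.cl bar α n := by
  let β : M.C one := M.eval (Env.nil.cons α)
    (lam (monus ⬝ suc zero ⬝ (monus ⬝ suc zero ⬝ (v1 ⬝ v0))))
  have hβ : ∀ k : M.N, β k = (1 - (1 - α k) : M.N) := fun k => by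
    simp [β, monus_def, succ_def, zero_def]
  obtain ⟨i, hi, h⟩ := exists_dig_eq (α := β) (fun k => by rw [hβ]; exact tsub_le_self) n
  refine ⟨i, hi, h.trans (bar_congr fun k hk => ?_)⟩
  rw [hβ, tsub_tsub_cancel_of_le (hα k hk)]

/-! ### Bounded products and bounded search -/

/-- `prod f b` is the product of the first `b` values of `f`. It serves as a bounded existential
quantifier, with the truth value `0` for truth. -/
def prod : Tm [] (one ⇒ one) := lam (lam (rc v0 (suc zero) (lam (lam (mul ⬝ v1 ⬝ (v3 ⬝ v0))))))

theorem prod_zero (f : M.C one) : M.cl prod f 0 = (1 : M.N) := by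
  rw [cl, prod]
  simp only [eval_lam, Str.eval_app, Str.eval_cst, Str.eval_var, Env.cons_z, ← zero_def,
    M.rec_zero]
  rfl

theorem prod_add_one (f : M.C one) (b : M.N) :
    M.cl prod f (b + 1) = (M.cl prod f b * f b : M.N) := by
  rw [← succ_def, cl, prod]
  simp only [eval_lam, Str.eval_app, Str.eval_cst, Str.eval_var, Env.cons_z, Env.cons_s,
    M.rec_succ, eval_mul, mul_def]
  exact congrArg (· * (f b : M.N)) (rec_congr fun r i => by simp)

theorem prod_eq_zero_iff (f : M.C one) (b : M.N) :
    M.cl prod f b = (0 : M.N) ↔ ∃ x < b, f x = (0 : M.N) := by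
  constructor
  · intro h
    by_contra! hf
    refine induction (P := fun k => k ≤ b → M.cl prod f k ≠ (0 : M.N))
      (Dec.imp (by fun_prop) (by fun_prop)) (fun _ => ?_) (fun k ih hk => ?_) b le_rfl h
    · rw [prod_zero]; exact one_ne_zero
    · rw [Order.add_one_le_iff] at hk
      rw [prod_add_one]
      exact mul_ne_zero (ih hk.le) (hf k hk)
  · rintro ⟨x, hx, hf⟩
    refine induction (P := fun k => x < k → M.cl prod f k = (0 : M.N))
      (Dec.imp (by fun_prop) (by fun_prop)) (fun h => absurd h not_lt_zero)
      (fun k ih hk => ?_) b hx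
    rw [prod_add_one]
    rcases (Order.lt_add_one_iff.1 hk).eq_or_lt with rfl | h
    · rw [hf, mul_zero]
    · rw [ih h, zero_mul]

/-- `search f b` is a zero of `f` below `b`, if there is one. In the recursion, the current value `r`
is kept if `f r = 0`, and is replaced by the current number otherwise. -/
def search : Tm [] (one ⇒ one) := lam (lam (rc v0 zero (lam (lam
  (add ⬝ (mul ⬝ v1 ⬝ (monus ⬝ suc zero ⬝ (v3 ⬝ v1))) ⬝
    (mul ⬝ v0 ⬝ (monus ⬝ suc zero ⬝ (monus ⬝ suc zero ⬝ (v3 ⬝ v1)))))))))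

theorem search_add_one (f : M.C one) (b : M.N) : M.cl search f (b + 1) =
    (M.cl search f b * (1 - f (M.cl search f b)) +
      b * (1 - (1 - f (M.cl search f b))) : M.N) := by
  have h : M.cl search f (b + 1) =
      M.eval ((((Env.nil.cons f).cons (b + 1)).cons (M.cl search f b)).cons b)
        (add ⬝ (mul ⬝ v1 ⬝ (monus ⬝ suc zero ⬝ (v3 ⬝ v1))) ⬝
          (mul ⬝ v0 ⬝ (monus ⬝ suc zero ⬝ (monus ⬝ suc zero ⬝ (v3 ⬝ v1))))) := by
    rw [← succ_def, cl, search]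
    simp only [eval_lam, Str.eval_app, Str.eval_cst, Str.eval_var, Env.cons_z, Env.cons_s,
      M.rec_succ]
    rw [rec_congr]
    intro r i
    simp
  rw [h]
  simp [add_def, mul_def, monus_def, succ_def, zero_def]

theorem search_spec {f : M.C one} {b : M.N} (h : ∃ x < b, f x = (0 : M.N)) :
    f (M.cl search f b) = (0 : M.N) := by
  obtain ⟨x, hx, hf⟩ := h
  refine induction (P := fun b => x < b → f (M.cl search f b) = (0 : M.N))
    (Dec.imp (by fun_prop) (by fun_prop)) (fun h => absurd h not_lt_zero) (fun b ih hb => ?_) b hx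
  rw [search_add_one]
  by_cases h0 : f (M.cl search f b) = (0 : M.N)
  · rw [h0]
    simpa using h0
  · rw [one_sub_eq_zero_iff.2 h0]
    rcases (Order.lt_add_one_iff.1 hb).eq_or_lt with rfl | h
    · simpa using hf
    · exact absurd (ih h) h0

theorem one_sub_eq_one_iff {x : M.N} : 1 - x = 1 ↔ x = 0 := by
  constructor
  · intro h
    by_contra h'
    rw [one_sub_eq_zero_iff.2 h'] at h
    exact zero_ne_one h
  · rintro rfl
    exact tsub_zero 1

theorem one_sub_ne_zero_iff {x : M.N} : 1 - x ≠ 0 ↔ x = 0 := by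
  rw [ne_eq, one_sub_eq_zero_iff, not_not]

theorem eq_of_eq_one_iff {x y : M.N} (hx : x ≤ 1) (hy : y ≤ 1) (h : x = 1 ↔ y = 1) : x = y := by
  rcases eq_zero_or_eq_one hx with rfl | rfl
  · rcases eq_zero_or_eq_one hy with rfl | rfl
    · rfl
    · exact h.2 rfl
  · exact (h.1 rfl).symm

/-- The distance of two numbers. -/
def dist : Tm [] (Ty.nat ⇒ Ty.nat ⇒ Ty.nat) :=
  lam (lam (add ⬝ (monus ⬝ v1 ⬝ v0) ⬝ (monus ⬝ v0 ⬝ v1)))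

theorem dist_eq_zero_iff (x y : M.N) : M.cl dist x y = (0 : M.N) ↔ x = y := by
  rw [cl, dist]
  simp only [eval_lam, Str.eval_app, Str.eval_var, Env.cons_z, Env.cons_s, eval_add, eval_monus,
    add_def, monus_def]
  rw [add_eq_zero, tsub_eq_zero_iff_le, tsub_eq_zero_iff_le, le_antisymm_iff]

/-! ### Binary trees of positive measure -/

/-- The meaning of `binTree`: `T` is the characteristic function of a set of codes of finite
0-1-sequences that is closed under initial segments. -/
structure IsBinTree (T : M.C one) : Prop where
  le_one (v : M.N) : T v ≤ (1 : M.N)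
  exists_bar (v : M.N) : T v = (1 : M.N) →
    ∃ α : M.C one, ∃ n : M.N, (∀ k : M.N, α k ≤ (1 : M.N)) ∧ v = M.cl bar α n
  closed (α : M.C one) (n m : M.N) : m ≤ n → T (M.cl bar α n) = (1 : M.N) →
    T (M.cl bar α m) = (1 : M.N)

/-- The meaning of `posMeasure`: the measure of `T` is at least `1 / k` for some `k`. -/
def PosMeasure (T : M.C one) : Prop :=
  ∃ k : M.N, ∀ n : M.N, (M.cl pow2 n : M.N) ≤ k * M.cl count T n

/-- The meaning of `uwwklAt`: if `T` is a binary tree of positive measure, then `α` is a path through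
`T`. -/
def IsPath (α T : M.C one) : Prop :=
  IsBinTree T → PosMeasure T → ∀ m : M.N, T (M.cl bar α m) = (1 : M.N)

/-! ### The tree of a function and an entry -/

/-- The characteristic function of the set of codes `⟨i₀, …, iₙ₋₁⟩` of 0-1-sequences such that
`i₀ = c` or such that `f` has no zero below `n`. -/
def tree : Tm [] (one ⇒ Ty.nat ⇒ one) :=
  lam (lam (lam (monus ⬝ suc zero ⬝ (ofClosed prod ⬝ lam (ofClosed prod ⬝
    lam (add ⬝ (ofClosed dist ⬝ v2 ⬝ (bar ⬝ (dig ⬝ v0) ⬝ v1)) ⬝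
      (mul ⬝ (ofClosed dist ⬝ (parity ⬝ v0) ⬝ v3) ⬝
        (monus ⬝ suc zero ⬝ (ofClosed prod ⬝ .var (.s (.s (.s (.s .z)))) ⬝ v1)))) ⬝
    (pow2 ⬝ v0)) ⬝ suc v0))))

section tree

variable (f : M.C one) (c : M.N)

theorem tree_def (v : M.N) : ∃ P : M.N, M.cl tree f c v = 1 - P ∧ (P = 0 ↔
    ∃ n ≤ v, ∃ i < (M.cl pow2 n : M.N), v = M.cl bar (M.cl dig i) n ∧
      (M.cl parity i = c ∨ ∀ x < n, f x ≠ (0 : M.N))) := by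
  rw [cl, tree]
  simp only [eval_lam, Str.eval_app, Str.eval_cst, Str.eval_var, Env.cons_z,
    eval_monus, monus_def, eval_ofClosed, zero_def, succ_def, zero_add]
  refine ⟨_, rfl, ?_⟩
  simp only [prod_eq_zero_iff, eval_lam, Str.eval_app, Str.eval_cst, Str.eval_var, Env.cons_z,
    Env.cons_s, eval_monus, monus_def, eval_ofClosed, zero_def, succ_def, zero_add, eval_add,
    add_def, eval_mul, mul_def, eval_bar, eval_dig, eval_parity, eval_pow2, add_eq_zero,
    mul_eq_zero, dist_eq_zero_iff, one_sub_eq_zero_iff, Order.lt_add_one_iff, ne_eq, not_exists,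
    not_and]

theorem tree_le_one (v : M.N) : M.cl tree f c v ≤ (1 : M.N) := by
  obtain ⟨P, hP, -⟩ := tree_def f c v
  rw [hP]
  exact tsub_le_self

theorem tree_eq_one_iff (v : M.N) : M.cl tree f c v = (1 : M.N) ↔
    ∃ n ≤ v, ∃ i < (M.cl pow2 n : M.N), v = M.cl bar (M.cl dig i) n ∧
      (M.cl parity i = c ∨ ∀ x < n, f x ≠ (0 : M.N)) := by
  obtain ⟨P, hP, h⟩ := tree_def f c v
  rw [hP, one_sub_eq_one_iff, h]

theorem tree_bar_iff (α : M.C one) (n : M.N) : M.cl tree f c (M.cl bar α n) = (1 : M.N) ↔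
    (∀ k < n, α k ≤ (1 : M.N)) ∧ (α 0 = c ∨ ∀ x < n, f x ≠ (0 : M.N)) := by
  rw [tree_eq_one_iff]
  constructor
  · rintro ⟨m, -, i, -, h, h'⟩
    obtain ⟨rfl, hd⟩ := bar_inj h
    refine ⟨fun k hk => (hd k hk).trans_le (dig_le_one i k), ?_⟩
    rcases eq_zero_or_eq_add_one n with rfl | ⟨m, rfl⟩
    · exact .inr fun x hx => absurd hx not_lt_zero
    · rwa [hd 0 (pos_iff_ne_zero.2 (add_one_ne_zero m)), dig_zero]
  · rintro ⟨hα, h⟩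
    obtain ⟨i, hi, hb⟩ := exists_dig_eq_of_lt hα
    refine ⟨n, le_bar α n, i, hi, hb.symm, ?_⟩
    rcases eq_zero_or_eq_add_one n with rfl | ⟨m, rfl⟩
    · exact .inr fun x hx => absurd hx not_lt_zero
    · rwa [← dig_zero, (bar_inj hb).2 0 (pos_iff_ne_zero.2 (add_one_ne_zero m))]

theorem tree_isBinTree : IsBinTree (M.cl tree f c) where
  le_one := tree_le_one f c
  exists_bar v h := by
    obtain ⟨n, -, i, -, h, -⟩ := (tree_eq_one_iff f c v).1 h
    exact ⟨M.cl dig i, n, dig_le_one i, h⟩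
  closed α n m hmn h := by
    rw [tree_bar_iff] at h ⊢
    exact ⟨fun k hk => h.1 k (hk.trans_le hmn),
      h.2.imp_right fun h x hx => h x (hx.trans_le hmn)⟩

/-- Half of the numbers below `b` have parity `c`. (For odd `b` there are at least as many as this,
since `half` is rounded down.) -/
theorem half_le_sum {g : M.C one} (hc : c ≤ 1)
    (hg : ∀ i : M.N, M.cl parity i = c → g i = (1 : M.N)) (b : M.N) :
    (M.cl half b : M.N) ≤ M.cl sum g b := by
  rcases eq_zero_or_eq_one hc with rfl | rfl
  · have h : b ≤ (M.cl sum g b + M.cl half b : M.N) := by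
      refine induction (P := fun b => b ≤ (M.cl sum g b + M.cl half b : M.N)) (by fun_prop)
        (by simp) (fun b h => ?_) b
      rw [sum_add_one, half_add_one, add_add_add_comm]
      refine add_le_add h ?_
      rcases eq_zero_or_eq_one (parity_le_one b) with hp | hp
      · rw [hg b hp]; exact le_self_add
      · rw [hp]; exact le_add_self
    conv_lhs at h => rw [← half_add_half b]
    rw [add_right_comm, add_le_add_iff_right] at h
    exact le_self_add.trans h
  · refine induction (P := fun b => (M.cl half b : M.N) ≤ M.cl sum g b) (by fun_prop) (by simp)
      (fun b h => ?_) b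
    rw [sum_add_one, half_add_one]
    refine add_le_add h ?_
    rcases eq_zero_or_eq_one (parity_le_one b) with hp | hp
    · rw [hp]; exact zero_le
    · rw [hp, hg b hp]

/-- At least half of the sequences of length `n + 1` start with `c`. The constant is `3` rather than
`2` for the sake of `n = 0`-independent arithmetic. -/
theorem tree_posMeasure (hc : c ≤ 1) : PosMeasure (M.cl tree f c) := by
  refine ⟨1 + 1, fun n => ?_⟩
  rw [count_def]
  set g : M.C one := M.eval ((Env.nil.cons (M.cl tree f c)).cons n)
    (lam (v2 ⬝ (bar ⬝ (dig ⬝ v0) ⬝ v1))) with hgdef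
  have hg : ∀ i : M.N, g i = M.cl tree f c (M.cl bar (M.cl dig i) n) := fun i => by
    simp [hgdef]
  rcases eq_zero_or_eq_add_one n with rfl | ⟨m, rfl⟩
  · have h1 : M.cl sum g 1 = (1 : M.N) := by
      rw [← zero_add (1 : M.N), sum_add_one, sum_zero, hg, (tree_bar_iff f c _ _).2
        ⟨fun k hk => absurd hk not_lt_zero, .inr fun k hk => absurd hk not_lt_zero⟩]
    rw [pow2_zero, h1, mul_one]
    exact le_add_self
  · have h := half_le_sum (g := g) c hc (fun i hi => by
      rw [hg, tree_bar_iff, dig_zero]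
      exact ⟨fun k _ => dig_le_one i k, .inl hi⟩) (M.cl pow2 (m + 1))
    rw [pow2_add_one, (parity_half_double _).2] at h
    rw [pow2_add_one]
    calc (M.cl pow2 m + M.cl pow2 m : M.N)
        ≤ M.cl sum g (M.cl pow2 m + M.cl pow2 m) + M.cl sum g (M.cl pow2 m + M.cl pow2 m) :=
          add_le_add h h
      _ = _ := by ring

variable {f c}

/-- The tree does not depend on `f` and `c` as far as `f` has no zeros. -/
theorem tree_eq_tree {f' : M.C one} {c' v : M.N} (h : ∀ x < v, f x ≠ (0 : M.N))
    (h' : ∀ x < v, f' x ≠ (0 : M.N)) : M.cl tree f c v = M.cl tree f' c' v := by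
  refine eq_of_eq_one_iff (tree_le_one _ _ _) (tree_le_one _ _ _) ?_
  rw [tree_eq_one_iff, tree_eq_one_iff]
  constructor
  · rintro ⟨n, hn, i, hi, hv, -⟩
    exact ⟨n, hn, i, hi, hv, .inr fun x hx => h' x (hx.trans_le hn)⟩
  · rintro ⟨n, hn, i, hi, hv, -⟩
    exact ⟨n, hn, i, hi, hv, .inr fun x hx => h x (hx.trans_le hn)⟩

theorem path_tree_le_one {α : M.C one} (h : IsPath α (M.cl tree f c)) (hc : c ≤ 1) :
    α 0 ≤ (1 : M.N) :=
  ((tree_bar_iff f c α 1).1 (h (tree_isBinTree f c) (tree_posMeasure f c hc) 1)).1 0 zero_lt_one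

/-- If `f` has a zero, then all paths start with `c`. -/
theorem path_tree_eq {α : M.C one} (h : IsPath α (M.cl tree f c)) (hc : c ≤ 1)
    {x : M.N} (hx : f x = (0 : M.N)) : α 0 = c :=
  ((tree_bar_iff f c α (x + 1)).1 (h (tree_isBinTree f c) (tree_posMeasure f c hc) _)).2.resolve_right
    fun h => h x (lt_add_one x) hx

end tree

/-- The full binary tree. -/
def full : Tm [] one := ofClosed tree ⬝ lam (suc zero) ⬝ zero

theorem cl_full : M.cl full = M.cl tree (M.eval .nil (lam (suc zero))) (0 : M.N) := by
  rw [cl, full]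
  simp [zero_def]

theorem full_eq_tree {f : M.C one} {c v : M.N} (h : ∀ x < v, f x ≠ (0 : M.N)) :
    M.cl full v = M.cl tree f c v := by
  rw [cl_full]
  refine tree_eq_tree (fun x _ => ?_) h
  simp only [eval_lam]
  exact M.succ_ne_zero _

theorem path_full_le_one {α : M.C one} (h : IsPath α (M.cl full)) : α 0 ≤ (1 : M.N) := by
  rw [cl_full] at h
  exact path_tree_le_one h zero_le

/-- If `f` has a zero, then the paths through the full tree and through the tree that is defined
from `f` by means of the complement of the first entry of the former path have different first
entries. -/
theorem path_ne {f α β : M.C one} (hα : IsPath α (M.cl full))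
    (hβ : IsPath β (M.cl tree f (1 - α 0 : M.N))) {x : M.N} (hx : f x = (0 : M.N)) :
    α 0 ≠ (β 0 : M.N) := by
  rw [path_tree_eq hβ tsub_le_self hx]
  rcases eq_zero_or_eq_one (path_full_le_one hα) with h | h <;> rw [h]
  · rw [tsub_zero]; exact zero_ne_one
  · rw [tsub_self]; exact one_ne_zero

/-! ### A search operator from an extensionality functional -/

/-- The search operator obtained from `Φ` and `Ξ`: for a function `f` with a zero, the path through
the full tree and the path through `tree f c`, for the entry `c` that differs from the first entry of
the former path, differ at `0`, hence the trees differ below the value of `Ξ`; this is therefore a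
bound on a zero of `f`. -/
def muTerm : Tm [] ((one ⇒ one) ⇒ (one ⇒ one ⇒ Ty.nat ⇒ Ty.nat) ⇒ two) :=
  lam (lam (lam (ofClosed search ⬝ v0 ⬝ (v1 ⬝ ofClosed full ⬝
    (ofClosed tree ⬝ v0 ⬝ (monus ⬝ suc zero ⬝ (v2 ⬝ ofClosed full ⬝ zero))) ⬝ suc zero))))

theorem muTerm_spec {Φ : M.C (one ⇒ one)} {Ξ : M.C (one ⇒ one ⇒ Ty.nat ⇒ Ty.nat)}
    (hΦ : ∀ T, IsPath (Φ T) T)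
    (hΞ : ∀ (k : M.N) (f g : M.C one), M.cl bar f (Ξ f g k) = M.cl bar g (Ξ f g k) →
      M.cl bar (Φ f) k = M.cl bar (Φ g) k) (f : M.C one) (hf : ∃ x : M.N, f x = (0 : M.N)) :
    f (M.cl muTerm Φ Ξ f) = (0 : M.N) := by
  obtain ⟨x, hx⟩ := hf
  have h : M.cl muTerm Φ Ξ f = M.cl search f
      (Ξ (M.cl full) (M.cl tree f (1 - Φ (M.cl full) 0 : M.N)) (1 : M.N)) := by
    rw [cl, muTerm]
    simp [monus_def, zero_def, succ_def]
  rw [h]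
  apply search_spec
  by_contra! hn
  refine path_ne (hΦ _) (hΦ _) hx ?_
  have := hΞ 1 _ _ (bar_congr fun k hk => full_eq_tree (f := f)
    (c := 1 - Φ (M.cl full) 0) fun y hy => hn y (hy.trans hk))
  exact (bar_inj this).2 0 zero_lt_one

/-! ### A path from a search operator -/

/-- The function of `m` that is zero if and only if no sequence of length `c + m` in `T` extends the
sequence with code `c`. (This length is at least that of the sequence with code `c`.) -/
def lvl : Tm [] (one ⇒ Ty.nat ⇒ one) :=
  lam (lam (lam (monus ⬝ suc zero ⬝ (ofClosed prod ⬝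
    lam (add ⬝ (ofClosed dist ⬝ (v3 ⬝ (bar ⬝ (dig ⬝ v0) ⬝ (add ⬝ v2 ⬝ v1))) ⬝ suc zero) ⬝
      (ofClosed prod ⬝ lam (ofClosed dist ⬝ (bar ⬝ (dig ⬝ v1) ⬝ v0) ⬝ v3) ⬝ suc v2)) ⬝
    (pow2 ⬝ (add ⬝ v1 ⬝ v0))))))

theorem lvl_def (T : M.C one) (c m : M.N) : ∃ P : M.N, M.cl lvl T c m = 1 - P ∧ (P = 0 ↔
    ∃ j < (M.cl pow2 (c + m) : M.N), T (M.cl bar (M.cl dig j) (c + m)) = (1 : M.N) ∧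
      ∃ n ≤ c, M.cl bar (M.cl dig j) n = c) := by
  rw [cl, lvl]
  simp only [eval_lam, Str.eval_app, Str.eval_cst, Str.eval_var, Env.cons_z, Env.cons_s,
    eval_monus, monus_def, eval_ofClosed, zero_def, succ_def, zero_add, eval_add, add_def,
    eval_pow2]
  refine ⟨_, rfl, ?_⟩
  simp only [prod_eq_zero_iff, eval_lam, Str.eval_app, Str.eval_cst, Str.eval_var, Env.cons_z,
    Env.cons_s, eval_ofClosed, zero_def, succ_def, zero_add, eval_add, add_def, eval_bar, eval_dig,
    add_eq_zero, dist_eq_zero_iff, Order.lt_add_one_iff]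

/-- The sequences may be given by arbitrary functions, since these have codes by digits. -/
theorem lvl_ne_zero_iff (T : M.C one) (c m : M.N) : M.cl lvl T c m ≠ (0 : M.N) ↔
    ∃ α : M.C one, (∀ k, α k ≤ (1 : M.N)) ∧ T (M.cl bar α (c + m)) = (1 : M.N) ∧
      ∃ n : M.N, M.cl bar α n = c := by
  obtain ⟨P, hP, h⟩ := lvl_def T c m
  rw [hP, one_sub_ne_zero_iff, h]
  constructor
  · rintro ⟨j, -, hT, n, -, hn⟩
    exact ⟨M.cl dig j, dig_le_one j, hT, n, hn⟩
  · rintro ⟨α, hα, hT, n, hn⟩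
    obtain ⟨j, hj, hb⟩ := exists_dig_eq hα (c + m)
    have hnc : n ≤ c := (le_bar α n).trans hn.le
    exact ⟨j, hj, by rwa [hb], n, hnc, (bar_inj' hb (hnc.trans le_self_add)).trans hn⟩

theorem exists_of_sum_ne_zero {g : M.C one} {b : M.N} (h : M.cl sum g b ≠ (0 : M.N)) :
    ∃ x < b, g x ≠ (0 : M.N) := by
  by_contra! hg
  refine h (induction (P := fun k => k ≤ b → M.cl sum g k = (0 : M.N))
    (Dec.imp (by fun_prop) (by fun_prop)) (fun _ => by simp) (fun k ih hk => ?_) b le_rfl)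
  rw [Order.add_one_le_iff] at hk
  rw [sum_add_one, ih hk.le, hg k hk, add_zero]

/-- Trees of positive measure have elements of all lengths. -/
theorem PosMeasure.lvl_ne_zero {T : M.C one} (hT : IsBinTree T) (h : PosMeasure T) (m : M.N) :
    M.cl lvl T (0 : M.N) m ≠ (0 : M.N) := by
  obtain ⟨k, hk⟩ := h
  have hc : M.cl count T m ≠ (0 : M.N) := by
    intro h0
    have := (pow2_pos m).trans_le (hk m)
    rw [h0, mul_zero] at this
    exact lt_irrefl _ this
  rw [count_def] at hc
  obtain ⟨j, -, hj⟩ := exists_of_sum_ne_zero hc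
  simp only [eval_lam, Str.eval_app, Str.eval_var, Env.cons_z, Env.cons_s, eval_bar,
    eval_dig] at hj
  rw [lvl_ne_zero_iff]
  refine ⟨M.cl dig j, dig_le_one j, ?_, 0, bar_zero _⟩
  rw [zero_add]
  exact (eq_zero_or_eq_one (hT.le_one _)).resolve_left hj

/-- The entry `0` or `1` by which the sequence with code `c` is extended: it is `0` if `μ` finds no
length at which the extension by `0` has no extensions in `T`, and `1` otherwise. -/
def next : Tm [] (two ⇒ one ⇒ one) :=
  lam (lam (lam (lam (monus ⬝ suc zero ⬝ (v0 ⬝ (v3 ⬝ v0))) ⬝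
    (ofClosed lvl ⬝ v1 ⬝ suc (pair ⬝ v0 ⬝ zero)))))

theorem next_def (μ : M.C two) (T : M.C one) (c : M.N) : M.cl next μ T c =
    (1 - M.cl lvl T (M.cl pair c 0 + 1 : M.N) (μ (M.cl lvl T (M.cl pair c 0 + 1 : M.N))) : M.N) := by
  rw [cl, next]
  simp [monus_def, zero_def, succ_def]

/-- The codes of the initial segments of the path. -/
def code : Tm [] (two ⇒ one ⇒ one) :=
  lam (lam (lam (rc v0 zero (lam (lam (suc (pair ⬝ v1 ⬝
    (ofClosed next ⬝ .var (.s (.s (.s (.s .z)))) ⬝ v3 ⬝ v1))))))))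

/-- The path through `T` that is obtained from the search operator. -/
def path : Tm [] (two ⇒ one ⇒ one) :=
  lam (lam (lam (ofClosed next ⬝ v2 ⬝ v1 ⬝ (ofClosed code ⬝ v2 ⬝ v1 ⬝ v0))))

theorem path_def (μ : M.C two) (T : M.C one) (n : M.N) :
    M.cl path μ T n = M.cl next μ T (M.cl code μ T n) := by
  rw [cl, path]
  simp

/-- The path is defined from the codes of its own initial segments. -/
theorem code_eq_bar (μ : M.C two) (T : M.C one) (n : M.N) :
    M.cl code μ T n = M.cl bar (M.cl path μ T) n := by
  have h0 : M.cl code μ T 0 = (0 : M.N) := by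
    rw [cl, code]
    simp [← zero_def, M.rec_zero]
  have hs : ∀ n : M.N, M.cl code μ T (n + 1) =
      (M.cl pair (M.cl code μ T n) (M.cl next μ T (M.cl code μ T n)) + 1 : M.N) := by
    intro n
    rw [← succ_def, cl, code]
    simp only [eval_lam, Str.eval_app, Str.eval_cst, Str.eval_var, Env.cons_z, Env.cons_s,
      M.rec_succ, eval_pair, eval_ofClosed]
    rw [succ_def]
    exact congrArg (fun x : M.N => M.cl pair x (M.cl next μ T x) + 1) (rec_congr fun r i => by simp)
  refine eq_induction (F := fun n => M.cl code μ T n) (G := fun n => M.cl bar (M.cl path μ T) n)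
    (by fun_prop) (by fun_prop) (by rw [h0, bar_zero]) (fun n h => ?_) n
  rw [hs, bar_add_one, path_def, h]

/-- The path through a binary tree of positive measure, provided that `μ` finds the zeros of the
functions `lvl T c`. -/
theorem isPath_path {μ : M.C two} {T : M.C one}
    (hμ : ∀ c : M.N, (∃ x : M.N, M.cl lvl T c x = (0 : M.N)) →
      M.cl lvl T c (μ (M.cl lvl T c)) = (0 : M.N)) : IsPath (M.cl path μ T) T := by
  intro hT hpos
  have hinf : ∀ c, M.cl lvl T c (μ (M.cl lvl T c)) ≠ (0 : M.N) →
      ∀ x, M.cl lvl T c x ≠ (0 : M.N) := fun c h x hx => h (hμ c ⟨x, hx⟩)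
  -- Infinitely many sequences in `T` extend each initial segment of the path. This is expressed by
  -- means of `μ`, because induction is available only without quantifiers.
  have hinv : ∀ m : M.N, M.cl lvl T (M.cl bar (M.cl path μ T) m)
      (μ (M.cl lvl T (M.cl bar (M.cl path μ T) m))) ≠ (0 : M.N) := by
    intro m
    refine induction (P := fun m => M.cl lvl T (M.cl bar (M.cl path μ T) m)
      (μ (M.cl lvl T (M.cl bar (M.cl path μ T) m))) ≠ (0 : M.N)) (by fun_prop) ?_
      (fun m ih => ?_) m
    · rw [bar_zero]
      exact hpos.lvl_ne_zero hT _
    · rw [bar_add_one, path_def, code_eq_bar]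
      set c := M.cl bar (M.cl path μ T) m with hc
      rw [next_def]
      by_cases h0 : M.cl lvl T (M.cl pair c 0 + 1 : M.N)
          (μ (M.cl lvl T (M.cl pair c 0 + 1 : M.N))) = (0 : M.N)
      swap
      · rwa [one_sub_eq_zero_iff.2 h0]
      · rw [h0, tsub_zero]
        intro h1
        set x₀ : M.N := μ (M.cl lvl T (M.cl pair c 0 + 1 : M.N))
        set x₁ : M.N := μ (M.cl lvl T (M.cl pair c 1 + 1 : M.N))
        -- A long sequence in `T` that extends `c` extends `c` by `0` or by `1`.
        obtain ⟨α, hα, hTα, n, hn⟩ := (lvl_ne_zero_iff T c _).1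
          (hinf c ih ((M.cl pair c 0 + 1 + x₀) + (M.cl pair c 1 + 1 + x₁)))
        rcases eq_zero_or_eq_one (hα n) with hαn | hαn
        · refine (lvl_ne_zero_iff T _ _).2 ⟨α, hα, hT.closed α _ _ ?_ hTα, n + 1, ?_⟩ h0
          · exact le_self_add.trans le_add_self
          · rw [bar_add_one, hn, hαn]
        · refine (lvl_ne_zero_iff T _ _).2 ⟨α, hα, hT.closed α _ _ ?_ hTα, n + 1, ?_⟩ h1
          · exact le_add_self.trans le_add_self
          · rw [bar_add_one, hn, hαn]
  intro m
  obtain ⟨α, -, hTα, n, hn⟩ := (lvl_ne_zero_iff T _ _).1 (hinf _ (hinv m) 0)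
  have := hT.closed α _ m ((le_bar (M.cl path μ T) m).trans le_self_add) hTα
  obtain ⟨rfl, -⟩ := bar_inj hn
  rwa [hn] at this

/-! ### Standard objects -/

variable (M) in
/-- The closure conditions on the standard objects. -/
structure StdLaws : Prop where
  closed {σ : Ty} (t : Tm [] σ) : M.std (M.cl t)
  app {σ τ : Ty} {f : M.C (σ ⇒ τ)} {x : M.C σ} : M.std f → M.std x → M.std (f x)

variable (M) in
/-- The meaning of `piTrans`: transfer for universal statements about standard functions. -/
def Trans : Prop := ∀ f : M.C one, M.std f →
  (∀ n : M.N, M.std n → f n ≠ (0 : M.N)) → ∀ n : M.N, f n ≠ (0 : M.N)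

variable (M) in
/-- The instance of the axiom of choice that yields a standard family of candidates for the
zeros of standard functions. -/
def ZeroChoice : Prop :=
  (∀ f : M.C one, M.std f → ∃ y : M.N, M.std y ∧
    ((∃ x : M.N, f x = (0 : M.N)) → f y = (0 : M.N))) →
  ∃ F : M.C (one ⇒ .seq .nat), M.std F ∧ ∀ f : M.C one, M.std f → ∃ i : M.N,
    i < M.cst (.len .nat) (F f) ∧
      ((∃ x : M.N, f x = (0 : M.N)) → f (M.cst (.get .nat) (F f) i) = (0 : M.N))

/-- The condition on the standard functional `Φ` in `uwwklPlus`. -/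
def IsStdUniform (Φ : M.C (one ⇒ one)) : Prop :=
  (∀ T : M.C one, M.std T → IsPath (Φ T) T) ∧
    ∀ T : M.C one, M.std T → ∀ S : M.C one, M.std S →
    (∀ n : M.N, M.std n → T n = (S n : M.N)) → ∀ n : M.N, M.std n → Φ T n = (Φ S n : M.N)

/-- `Σ⁰₁` statements about standard functions without standard witnesses would yield two standard
trees that agree on the standard numbers, but have paths with different first entries. -/
theorem trans_of_isStdUniform (hM : M.StdLaws) {Φ : M.C (one ⇒ one)} (hΦs : M.std Φ)
    (hΦ : IsStdUniform Φ) : M.Trans := by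
  intro f hf hn x hx
  have h0 : M.std (0 : M.N) := hM.closed zero
  have h1 : M.std (1 : M.N) := hM.closed (suc zero)
  have hfull : M.std (M.cl full) := hM.closed full
  have hc : M.std (1 - Φ (M.cl full) 0 : M.N) := by
    rw [← monus_def]
    exact hM.app (hM.app (hM.closed _) h1) (hM.app (hM.app hΦs hfull) h0)
  have ht : M.std (M.cl tree f (1 - Φ (M.cl full) 0 : M.N)) :=
    hM.app (hM.app (hM.closed _) hf) hc
  refine path_ne (hΦ.1 _ hfull) (hΦ.1 _ ht) hx (hΦ.2 _ hfull _ ht (fun v hv => ?_) 0 h0)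
  refine full_eq_tree fun y hy hfy => ?_
  -- A standard zero can be found below a standard number that exceeds some zero.
  exact hn (M.cl search f v) (hM.app (hM.app (hM.closed _) hf) hv) (search_spec ⟨y, hy, hfy⟩)

/-- The first component of a pair with `g c x = 0` and `c, x < m`, if there is one. -/
def searchFst : Tm [] ((Ty.nat ⇒ one) ⇒ one) :=
  lam (lam (ofClosed search ⬝ lam (v2 ⬝ v0 ⬝ (ofClosed search ⬝ (v2 ⬝ v0) ⬝ v1)) ⬝ v0))

/-- The value of `g` at the pair that is found by bounded search. -/
def searchVal : Tm [] ((Ty.nat ⇒ one) ⇒ one) :=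
  lam (lam (v1 ⬝ (ofClosed searchFst ⬝ v1 ⬝ v0) ⬝
    (ofClosed search ⬝ (v1 ⬝ (ofClosed searchFst ⬝ v1 ⬝ v0)) ⬝ v0)))

theorem searchVal_def (g : M.C (.nat ⇒ one)) (m : M.N) : M.cl searchVal g m =
    g (M.cl searchFst g m) (M.cl search (g (M.cl searchFst g m)) m) := by
  rw [cl, searchVal]
  simp

theorem searchVal_eq_zero {g : M.C (.nat ⇒ one)} {c x m : M.N} (hc : c < m) (hx : x < m)
    (h : g c x = (0 : M.N)) : M.cl searchVal g m = (0 : M.N) := by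
  have h' : ∀ m, M.cl searchFst g m = M.cl search (M.eval ((Env.nil.cons g).cons m)
      (lam (v2 ⬝ v0 ⬝ (ofClosed search ⬝ (v2 ⬝ v0) ⬝ v1)))) m := by
    intro m
    rw [cl, searchFst]
    simp
  have key := search_spec (f := M.eval ((Env.nil.cons g).cons m)
    (lam (v2 ⬝ v0 ⬝ (ofClosed search ⬝ (v2 ⬝ v0) ⬝ v1)))) (b := m) ⟨c, hc, by
      simpa using search_spec ⟨x, hx, h⟩⟩
  rw [searchVal_def, h']
  simpa using key

/-- Transfer for universal statements with two number quantifiers. -/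
theorem Trans.forall₂ (h : M.Trans) (hM : M.StdLaws) {g : M.C (.nat ⇒ one)} (hg : M.std g)
    (hgs : ∀ c : M.N, M.std c → ∀ x : M.N, g c x ≠ (0 : M.N)) (c x : M.N) :
    g c x ≠ (0 : M.N) := by
  intro h0
  refine h (M.cl searchVal g) (hM.app (hM.closed _) hg) (fun m hm => ?_) (c + x + 1)
    (searchVal_eq_zero ?_ ?_ h0)
  · rw [searchVal_def]
    exact hgs _ (hM.app (hM.app (hM.closed _) hg) hm) _
  · exact Order.lt_add_one_iff.2 le_self_add
  · exact Order.lt_add_one_iff.2 le_add_self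

/-- The search operator that is obtained from finitely many candidates. -/
def muOfSeq : Tm [] ((one ⇒ Ty.seq .nat) ⇒ two) :=
  lam (lam (get (v1 ⬝ v0) (ofClosed search ⬝ lam (v1 ⬝ get (v2 ⬝ v1) v0) ⬝ len (v1 ⬝ v0))))

theorem muOfSeq_spec {F : M.C (one ⇒ .seq .nat)} {f : M.C one} {i : M.N}
    (hi : i < M.cst (.len .nat) (F f)) (h : f (M.cst (.get .nat) (F f) i) = (0 : M.N)) :
    f (M.cl muOfSeq F f) = (0 : M.N) := by
  have key := search_spec (f := M.eval ((Env.nil.cons F).cons f) (lam (v1 ⬝ get (v2 ⬝ v1) v0)))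
    (b := M.cst (.len .nat) (F f)) ⟨i, hi, by simpa using h⟩
  rw [cl, muOfSeq]
  simpa using key

/-- Zero if and only if `x`, but not the value of `μ`, is a zero of `lvl T c`. -/
def missed : Tm [] (two ⇒ one ⇒ Ty.nat ⇒ one) :=
  lam (lam (lam (lam (add ⬝ (ofClosed lvl ⬝ v2 ⬝ v1 ⬝ v0) ⬝
    (monus ⬝ suc zero ⬝ (ofClosed lvl ⬝ v2 ⬝ v1 ⬝ (v3 ⬝ (ofClosed lvl ⬝ v2 ⬝ v1))))))))

theorem missed_eq_zero_iff (μ : M.C two) (T : M.C one) (c x : M.N) :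
    M.cl missed μ T c x = (0 : M.N) ↔
      M.cl lvl T c x = (0 : M.N) ∧ M.cl lvl T c (μ (M.cl lvl T c)) ≠ (0 : M.N) := by
  rw [cl, missed]
  simp [add_def, monus_def, zero_def, succ_def, one_sub_eq_zero_iff]

/-- The search operator `μ` that choice provides is correct for standard functions. The path that is
computed from `μ` and a standard tree `T` requires that `μ` is correct for `lvl T c`, for all `c`. For
standard `c` it is, and transfer extends this to all `c`. -/
theorem exists_isStdUniform (hM : M.StdLaws) (hC : M.ZeroChoice) (h : M.Trans) :
    ∃ Φ : M.C (one ⇒ one), M.std Φ ∧ IsStdUniform Φ := by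
  obtain ⟨F, hF, hFs⟩ := hC fun f hf => by
    by_cases hx : ∃ x : M.N, M.std x ∧ f x = (0 : M.N)
    · obtain ⟨x, hx, hfx⟩ := hx
      exact ⟨x, hx, fun _ => hfx⟩
    · refine ⟨0, hM.closed zero, fun ⟨x, hfx⟩ => absurd hfx (h f hf (fun n hn h0 => ?_) x)⟩
      exact hx ⟨n, hn, h0⟩
  set μ := M.cl muOfSeq F
  have hμs : M.std μ := hM.app (hM.closed _) hF
  have hμ : ∀ f : M.C one, M.std f → (∃ x : M.N, f x = (0 : M.N)) → f (μ f) = (0 : M.N) := by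
    intro f hf hx
    obtain ⟨i, hi, hfi⟩ := hFs f hf
    exact muOfSeq_spec hi (hfi hx)
  refine ⟨M.cl path μ, hM.app (hM.closed _) hμs, fun T hT => isPath_path fun c ⟨x, hx⟩ => ?_,
    fun T hT S hS hTS => ?_⟩
  · by_contra h0
    refine h.forall₂ hM (g := M.cl missed μ T) (hM.app (hM.app (hM.closed _) hμs) hT)
      (fun c hc x h0 => ?_) c x ((missed_eq_zero_iff μ T c x).2 ⟨hx, h0⟩)
    rw [missed_eq_zero_iff] at h0
    exact h0.2 (hμ _ (hM.app (hM.app (hM.closed _) hT) hc) ⟨x, h0.1⟩)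
  · -- By transfer, standard functions that agree on the standard numbers are equal.
    have hd : ∀ n : M.N, M.eval ((Env.nil.cons T).cons S) (lam (monus ⬝ suc zero ⬝
        (ofClosed dist ⬝ (v2 ⬝ v0) ⬝ (v1 ⬝ v0)))) n ≠ (0 : M.N) ↔ T n = (S n : M.N) := by
      intro n
      simp only [eval_lam, Str.eval_app, Str.eval_cst, Str.eval_var, Env.cons_z, Env.cons_s,
        eval_monus, monus_def, eval_ofClosed, zero_def, succ_def, zero_add]
      rw [one_sub_ne_zero_iff, dist_eq_zero_iff]
    have hs : M.std (M.eval ((Env.nil.cons T).cons S) (lam (monus ⬝ suc zero ⬝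
        (ofClosed dist ⬝ (v2 ⬝ v0) ⬝ (v1 ⬝ v0))))) := by
      have : M.eval ((Env.nil.cons T).cons S) (lam (monus ⬝ suc zero ⬝
          (ofClosed dist ⬝ (v2 ⬝ v0) ⬝ (v1 ⬝ v0)))) = M.cl (lam (lam (lam (monus ⬝ suc zero ⬝
          (ofClosed dist ⬝ (v2 ⬝ v0) ⬝ (v1 ⬝ v0)))))) T S := by
        rw [cl, eval_lam, eval_lam]
      rw [this]
      exact hM.app (hM.app (hM.closed _) hT) hS
    have : T = S := M.app_ext T S fun n => (hd n).1
      (h _ hs (fun n hn => (hd n).2 (hTS n hn)) n)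
    rw [this]
    exact fun _ _ => rfl

end Model

open Tm Fm

namespace Model

variable {M : Model} {b : Bool} {Γ : Ctx}

/-! ### The meaning of the sentences -/

theorem sat_binTree (e : Env M.C Γ) (T : Tm Γ one) :
    M.sat e (binTree T : Fm b Γ) ↔ IsBinTree (M.eval e T) := by
  simp only [binTree, Str.sat_all, Str.sat_imp, Str.sat_eq, Str.sat_bot, imp_false, not_forall,
    not_not, not_exists, not_and, exists_prop, M.eqn_iff, Str.eval_app, Str.eval_cst, Str.eval_var,
    Str.eval_wk, Env.cons_z, Env.cons_s, eval_bar, eval_monus, monus_def, ← le_def, zero_def,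
    succ_def, zero_add]
  exact ⟨fun ⟨h₁, h₂, h₃⟩ => ⟨h₁, h₂, h₃⟩, fun ⟨h₁, h₂, h₃⟩ => ⟨h₁, h₂, h₃⟩⟩

theorem sat_posMeasure (e : Env M.C Γ) (T : Tm Γ one) :
    M.sat e (posMeasure T : Fm b Γ) ↔ PosMeasure (M.eval e T) := by
  rw [posMeasure, Str.sat_ex]
  simp only [Str.sat_all, Str.sat_eq, M.eqn_iff, Str.eval_app, Str.eval_cst, Str.eval_var,
    Str.eval_wk, Env.cons_z, Env.cons_s, eval_pow2, eval_mul, eval_count, mul_def, eval_monus,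
    monus_def, zero_def, ← le_def, PosMeasure]

theorem sat_uwwklAt (e : Env M.C Γ) (α T : Tm Γ one) :
    M.sat e (uwwklAt α T : Fm b Γ) ↔ IsPath (M.eval e α) (M.eval e T) := by
  simp only [uwwklAt, Str.sat_all, Str.sat_imp, sat_binTree, sat_posMeasure, Str.sat_eq, M.eqn_iff,
    Str.eval_app, Str.eval_cst, Str.eval_var, Str.eval_wk, Env.cons_z, eval_bar, zero_def,
    succ_def, zero_add, IsPath]

theorem sat_approx (e : Env M.C Γ) (f g : Tm Γ one) : M.sat e (approx f g) ↔
    ∀ n : M.N, M.std n → (M.eval e f n : M.N) = M.eval e g n := by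
  simp only [approx, Str.sat_all, Str.sat_imp, Str.sat_st, Str.sat_eq, M.eqn_iff, Str.eval_app,
    Str.eval_var, Str.eval_wk, Env.cons_z]

theorem sat_uwwklPlus (e : Env M.C []) :
    M.sat e uwwklPlus ↔ ∃ Φ : M.C (one ⇒ one), M.std Φ ∧ IsStdUniform Φ := by
  simp only [uwwklPlus, Str.sat_all, Str.sat_imp, Str.sat_st, Str.sat_bot, sat_uwwklAt,
    sat_approx, Str.eval_app, Str.eval_var, Env.cons_z, Env.cons_s, imp_false, not_forall,
    not_not, not_exists, not_and, exists_prop, IsStdUniform]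

theorem sat_piTrans (e : Env M.C []) : M.sat e piTrans ↔ M.Trans := by
  simp only [piTrans, Str.sat_all, Str.sat_imp, Str.sat_st, Str.sat_eq, Str.sat_bot, M.eqn_iff,
    Str.eval_app, Str.eval_cst, Str.eval_var, Env.cons_z, Env.cons_s, zero_def, Trans, ne_eq, Not]

theorem sat_isMu (e : Env M.C Γ) (μ : Tm Γ two) : M.sat e (isMu μ : Fm b Γ) ↔
    ∀ f : M.C one, (∃ x : M.N, f x = (0 : M.N)) → f (M.eval e μ f) = (0 : M.N) := by
  simp only [isMu, Str.sat_all, Str.sat_imp, Str.sat_eq, Str.sat_bot, imp_false, not_forall,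
    not_not, M.eqn_iff, Str.eval_app, Str.eval_cst, Str.eval_var, Str.eval_wk, Env.cons_z,
    Env.cons_s, zero_def]

theorem sat_muToUwwkl (e : Env M.C []) : M.sat e (muToUwwkl path) := by
  simp only [muToUwwkl, uwwkl, Str.sat_all, Str.sat_imp, sat_isMu, sat_uwwklAt, Str.eval_app,
    Str.eval_var, Str.eval_wk, Env.cons_z, eval_ofClosed]
  exact fun μ hμ T => isPath_path fun c hx => hμ _ hx

theorem sat_uwwklToMu (e : Env M.C []) : M.sat e (uwwklToMu muTerm) := by
  simp only [uwwklToMu, extFunctional, uwwkl, Str.sat_all, Str.sat_imp, sat_isMu, sat_uwwklAt,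
    Str.sat_eq, M.eqn_iff, Str.eval_app, Str.eval_var, Str.eval_wk, Env.cons_z, Env.cons_s,
    eval_ofClosed, eval_bar]
  exact fun Φ Ξ hΦ hΞ f hf => muTerm_spec hΦ hΞ f hf

/-! ### Models of the theory with standard objects -/

/-- The schemas on `st` hold in the models of their instances. -/
theorem stdLaws_of_sat (hM : ∀ {Γ : Ctx} (A : Fm true Γ),
    (∀ (Δ : Ctx) (f : Sub Γ Δ), Prf RCALambda Δ [] (A.subst f)) → ∀ e : Env M.C Γ, M.sat e A) :
    M.StdLaws where
  closed {σ} t := by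
    refine hM (std t) (fun Δ f => ?_) .nil
    have : t.subst f = ofClosed t :=
      congrArg t.subst (funext fun _ => funext fun v => by cases v)
    rw [Fm.subst, this]
    exact .ax (.st_closed t)
  app {σ τ f x} hf hx :=
    hM (Γ := [σ, σ ⇒ τ]) (.imp (std v1) (.imp (std v0) (std (v1 ⬝ v0))))
      (fun Δ s => .ax (.st_app _ _)) ((Env.nil.cons f).cons x) hf hx

/-- The axiom of choice, applied to `(∃ x, f x = 0) → f y = 0`. -/
theorem zeroChoice_of_sat (hM : ∀ {Γ : Ctx} (A : Fm true Γ),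
    (∀ (Δ : Ctx) (f : Sub Γ Δ), Prf RCALambda Δ [] (A.subst f)) → ∀ e : Env M.C Γ, M.sat e A) :
    M.ZeroChoice := by
  have h := hM (Γ := []) (.imp
      (allst one (exst .nat (.imp (ex .nat (.eq (v2 ⬝ v0) zero)) (.eq (v1 ⬝ v0) zero))))
      (exst (one ⇒ .seq .nat) (allst one (.ex .nat (.and (mem v0 (v2 ⬝ v1))
        (.imp (ex .nat (.eq (v2 ⬝ v0) zero)) (.eq (v1 ⬝ v0) zero)))))))
    (fun Δ f => .ax (.hac_int (.imp (ex .nat (.eq (v2 ⬝ v0) zero)) (.eq (v1 ⬝ v0) zero))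
      (.imp (.imp (.all (.imp (.eq _ _) .bot)) .bot) (.eq _ _)))) .nil
  simp only [mem, eqOf, Str.sat_all, Str.sat_imp, Str.sat_st, Str.sat_eq, Str.sat_bot, imp_false,
    not_forall, not_not, not_exists, not_and, exists_prop, M.eqn_iff, Str.eval_app, Str.eval_cst,
    Str.eval_var, Str.eval_wk, Env.cons_z, Env.cons_s, eval_monus, monus_def, succ_def, ← le_def,
    zero_def, Order.add_one_le_iff] at h
  intro hf
  obtain ⟨F, hF, hFs⟩ := h hf
  refine ⟨F, hF, fun f hf => ?_⟩
  obtain ⟨y, ⟨i, hi, rfl⟩, hy⟩ := hFs f hf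
  exact ⟨i, hi, hy⟩

end Model

end FT

/-- `RCA₀^Λ` proves that `UWWKL⁺` is equivalent to `Π⁰₁-TRANS`, and there are closed terms `s` and
`t` for which `RCA₀^ω` proves the two effective implications. -/
theorem theorem3p4 :
    FT.Provable FT.RCALambda (FT.Fm.iff FT.uwwklPlus FT.piTrans) ∧
      ∃ (s : FT.Tm [] (FT.two ⇒ FT.one ⇒ FT.one))
        (t : FT.Tm [] ((FT.one ⇒ FT.one) ⇒ (FT.one ⇒ FT.one ⇒ FT.Ty.nat ⇒ FT.Ty.nat) ⇒ FT.two)),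
        FT.Provable (FT.RCAomega false) (FT.Fm.and (FT.muToUwwkl s) (FT.uwwklToMu t)) := by
  constructor
  · by_contra h₀
    obtain ⟨M, hM₀, hM⟩ := FT.exists_model .omega (fun _ => .st_eq) h₀
    refine hM₀ ((M.sat_iff _ _ _).2 ?_)
    rw [FT.Model.sat_uwwklPlus, FT.Model.sat_piTrans]
    have hS := FT.Model.stdLaws_of_sat hM
    exact ⟨fun ⟨Φ, hΦs, hΦ⟩ => FT.Model.trans_of_isStdUniform hS hΦs hΦ,
      FT.Model.exists_isStdUniform hS (FT.Model.zeroChoice_of_sat hM)⟩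
  · refine ⟨FT.Model.path, FT.Model.muTerm, ?_⟩
    by_contra h₀
    obtain ⟨M, hM₀, -⟩ := FT.exists_model id (fun h => by cases h) h₀
    exact hM₀ ((M.sat_and _ _ _).2 ⟨FT.Model.sat_muToUwwkl _, FT.Model.sat_uwwklToMu _⟩)
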